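/- Setting. Let $\mathcal S=\mathbb R^d$, let $\mathcal A$ be a measurable action space, and let $\sigma>0$, $H\ge 1$. For $f:\mathcal S\times\mathcal A\to\mathcal S$ consider the $H$-step Markov decision process with transitions $s'\sim\mathcal N(f(s,a),\sigma^2 I)$, a known measurable reward $r(s,a)\in[0,1]$ and initial distribution $\rho$; write $V_{0,f}^{\pi}(s)$ for the expected cumulative reward of a (non-stationary, randomized Markov) policy $\pi$ started at $s$, and $V_{0,f}^*(s)=\sup_\pi V_{0,f}^\pi(s)$. Let $\mathcal F$ be a class of such functions $f$ (with a $\sigma$-algebra for which $(f,s,a)\mapsto f(s,a)$ is jointly measurable) and put $\|f\|_2:=\sup_{s,a}\|f(s,a)\|_2$. Assume: (i) $\|f\|_2\le C$ for all $f\in\mathcal F$; (ii) for every $\epsilon>0$ the covering number $\mathcal N(\mathcal F,\epsilon,\|\cdot\|_2)$, the least cardinality of a subset of $\mathcal F$ such that each $f\in\mathcal F$ is within distance $\epsilon$ of it, is finite; (iii) for every $\epsilon>0$ the eluder dimension $\dim_E(\mathcal F,\epsilon)$ is finite. Here $(s,a)$ is $\epsilon$-dependent on $(s_1,a_1),\dots,(s_n,a_n)$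 if all $f,\tilde f\in\mathcal F$ with $\sqrt{\sum_i\|f(s_i,a_i)-\tilde f(s_i,a_i)\|_2^2}\le\epsilon$ satisfy $\|f(s,a)-\tilde f(s,a)\|_2\le\epsilon$, and is $\epsilon$-independent otherwise; $\dim_E(\mathcal F,\epsilon)$ is the largest length of a sequence in $\mathcal S\times\mathcal A$ such that, for some $\epsilon'\ge\epsilon$, each element is $\epsilon'$-independent of its predecessors. Algorithm (Thompson sampling, SPEDE). The true dynamics $f^*\in\mathcal F$ is drawn from a prior $\mathbb P$ on $\mathcal F$. In each episode $k=1,2,\dots$ the learner draws $f_k$ from the posterior of $f^*$ given the transitions $(s_h^j,a_h^j,s_{h+1}^j)$, $j<k$, $0\le h<H$; computes by dynamic programming a policy $\pi_k$ whose action at each step $h<H$ and state $s$ maximizes $Q_h(s,\cdot)$ for the model $f_k$ (where $V_H=0$, $Q_h(s,a)=r(s,a)+\mathbb E_{s'\sim\mathcal N(f_k(s,a),\sigma^2I)}V_{h+1}(s')$ and $V_h(s)=\sup_aQ_h(s,a)$; it is assumed that a measurable selection of maximizers is available); and runs $\pi_k$ for $H$ steps under $f^*$ from $s_0^k\sim\rho$.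 Let $T=KH$ and $$\mathrm{Regret}(K)=\sum_{k=1}^K\left[V_{0,f^*}^*(s_0^k)-V_{0,f^*}^{\pi_k}(s_0^k)\right].$$ Theorem (Regret Bound). There is an absolute exponent $p\in\mathbb N$, and for every $(d,\sigma,C)$ a constant $c=c(d,\sigma,C)$, such that for all $\mathcal A,\mathcal F,r,\rho,\mathbb P,H\ge1,K\ge1$ as above $\mathrm{Regret}(K)$ is integrable and $$\mathbb E\left[\mathrm{Regret}(K)\right]\le c\,(1+\log T)^p\sqrt{H^2T\cdot\max\{1,\log\mathcal N(\mathcal F,T^{-1/2},\|\cdot\|_2)\}\cdot\max\{1,\dim_E(\mathcal F,T^{-1/2})\}},$$ the expectation being over the prior draw of $f^*$, the noise and the randomness of the algorithm; that is, $\mathbb E[\mathrm{Regret}(K)]\le\tilde O\big(\sqrt{H^2T\cdot\log\mathcal N(\mathcal F,T^{-1/2},\|\cdot\|_2)\cdot\dim_E(\mathcal F,T^{-1/2})}\big)$. -/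

import Mathlib

open MeasureTheory ProbabilityTheory
open scoped ENNReal

namespace SPEDE

noncomputable section

/-- The state space `ℝ^d` with its Euclidean norm. -/
abbrev State (d : ℕ) : Type := EuclideanSpace ℝ (Fin d)

/-! ### Complexity of a class of dynamics functions -/

section Complexity

variable {d : ℕ} {A : Type*}

/-- The norm `‖f‖₂ = sup_{s, a} ‖f(s, a)‖₂`, as an extended nonnegative number. -/
def fnNorm (f : State d → A → State d) : ℝ≥0∞ := ⨆ s, ⨆ a, ‖f s a‖ₑ

/-- `N` is an `ε`-cover of `F` by elements of `F`, for the distance `‖f - g‖₂`. -/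
def IsFnCover (F : Set (State d → A → State d)) (ε : ℝ) (N : Set (State d → A → State d)) :
    Prop :=
  N ⊆ F ∧ ∀ f ∈ F, ∃ g ∈ N, fnNorm (f - g) ≤ ENNReal.ofReal ε

/-- The covering number: the least cardinality of an `ε`-cover. -/
def fnCoveringNumber (F : Set (State d → A → State d)) (ε : ℝ) : ℕ∞ :=
  ⨅ N : {N : Set (State d → A → State d) // IsFnCover F ε N}, N.1.encard

/-- The pair `x` is `ε`-dependent on the finite sequence `y` with respect to `F`. -/
def EpsDependent (F : Set (State d → A → State d)) (ε : ℝ) {n : ℕ} (y : Fin n → State d × A)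
    (x : State d × A) : Prop :=
  ∀ f ∈ F, ∀ g ∈ F,
    Real.sqrt (∑ i, ‖f (y i).1 (y i).2 - g (y i).1 (y i).2‖ ^ 2) ≤ ε →
      ‖f x.1 x.2 - g x.1 x.2‖ ≤ ε

/-- There is a sequence of `n` state-action pairs such that, for some `ε' ≥ ε`, every element
is `ε'`-independent of its predecessors. -/
def HasEluderSequence (F : Set (State d → A → State d)) (ε : ℝ) (n : ℕ) : Prop :=
  ∃ ε', ε ≤ ε' ∧ ∃ x : ℕ → State d × A,
    ∀ i < n, ¬ EpsDependent F ε' (fun j : Fin i => x j) (x i)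

/-- The eluder dimension: the length of the longest such sequence (`⊤` if they are unbounded). -/
def eluderDim (F : Set (State d → A → State d)) (ε : ℝ) : ℕ∞ :=
  ⨆ n : {n : ℕ // HasEluderSequence F ε n}, (n.1 : ℕ∞)

end Complexity

/-! ### The Markov decision process with Gaussian noise -/

section MDP

variable {d : ℕ} {A : Type*} [MeasurableSpace A]

/-- The Gaussian kernel of bandwidth `σ`. -/
def gaussKernel (σ : ℝ) (x y : State d) : ℝ := Real.exp (-‖x - y‖ ^ 2 / (2 * σ ^ 2))

/-- The Gaussian distribution `N(m, σ² I)`, with density `(2πσ²)^{-d/2} k(m, s')`. It is the law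
of the next state when `m` is the value of the dynamics function. -/
def transition (σ : ℝ) (m : State d) : Measure (State d) :=
  volume.withDensity fun s' =>
    ENNReal.ofReal ((2 * Real.pi * σ ^ 2) ^ (-(d : ℝ) / 2) * gaussKernel σ m s')

/-- A non-stationary stochastic Markov policy. -/
structure Policy (d : ℕ) (A : Type*) [MeasurableSpace A] where
  /-- the action distribution at each step -/
  act : ℕ → Kernel (State d) A
  markov : ∀ h, IsMarkovKernel (act h)

/-- The law of `s_t` when `s_0 = s`, the dynamics function is `f` and the policy is `π`. -/
def stateLaw (σ : ℝ) (f : State d → A → State d) (π : Policy d A) (s : State d) :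
    ℕ → Measure (State d)
  | 0 => Measure.dirac s
  | t + 1 => (stateLaw σ f π s t).bind fun x =>
      (π.act t x).bind fun a => transition σ (f x a)

/-- The value `V_0^π(s)`: the expected cumulative reward over `H` steps from `s_0 = s`. -/
def value (σ : ℝ) (r : State d → A → ℝ) (H : ℕ) (f : State d → A → State d)
    (π : Policy d A) (s : State d) : ℝ :=
  ∑ t ∈ Finset.range H, ∫ x, ∫ a, r x a ∂(π.act t x) ∂(stateLaw σ f π s t)

/-- The optimal value `V_0^*(s)`, the supremum of `V_0^π(s)` over all policies. -/
def optValue (σ : ℝ) (r : State d → A → ℝ) (H : ℕ) (f : State d → A → State d)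
    (s : State d) : ℝ :=
  ⨆ π : Policy d A, value σ r H f π s

/-- The planning value with `n` steps to go: `V = 0` with no step to go, and otherwise
`V(s) = sup_a (r(s, a) + ∫ V'(s') N(f(s, a), σ² I)(ds'))`. -/
def planV (σ : ℝ) (r : State d → A → ℝ) (f : State d → A → State d) : ℕ → State d → ℝ
  | 0, _ => 0
  | n + 1, s => ⨆ a, (r s a + ∫ s', planV σ r f n s' ∂(transition σ (f s a)))

/-- The planning `Q`-function `Q_h(s, a)` of dynamic programming with horizon `H`, for `h < H`. -/
def planQ (σ : ℝ) (r : State d → A → ℝ) (H : ℕ) (f : State d → A → State d) (h : ℕ)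
    (s : State d) (a : A) : ℝ :=
  r s a + ∫ s', planV σ r f (H - 1 - h) s' ∂(transition σ (f s a))

end MDP

/-! ### The Thompson-sampling algorithm -/

section Algorithm

variable {d : ℕ} {A : Type*} [MeasurableSpace A]
  {F : Set (State d → A → State d)} [MeasurableSpace F]

/-- The policy that a planner returns for the model `f`. -/
def plannedPolicy (plan : ℕ → Kernel (F × State d) A) [∀ h, IsMarkovKernel (plan h)] (f : F) :
    Policy d A where
  act h := (plan h).sectR f
  markov _ := inferInstance

/-- The planner is dynamic programming: for every model `f ∈ F`, step `h < H` and state `s`, the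
action is a maximizer of `Q_h(s, ·)` (ties may be broken at random). -/
def IsGreedyPlanner (σ : ℝ) (r : State d → A → ℝ) (H : ℕ)
    (plan : ℕ → Kernel (F × State d) A) : Prop :=
  ∀ (f : F), ∀ h < H, ∀ s, ∀ᵐ a ∂(plan h (f, s)),
    ∀ b, planQ σ r H f.1 h s b ≤ planQ σ r H f.1 h s a

/-- `κ` gives the conditional law of `X` given the `σ`-algebra `m`. -/
def IsCondLaw {Ω B : Type*} (m : MeasurableSpace Ω) [MeasurableSpace Ω] [MeasurableSpace B]
    (μ : Measure Ω) (X : Ω → B) (κ : Ω → Measure B) : Prop :=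
  ∀ G, MeasurableSet[m] G → ∀ E, MeasurableSet E → μ (G ∩ X ⁻¹' E) = ∫⁻ ω in G, κ ω E ∂μ

/-- `κ` is a posterior distribution of `X` given the information `m`: a regular conditional
distribution. -/
structure IsPosterior {Ω B : Type*} (m : MeasurableSpace Ω) [MeasurableSpace Ω]
    [MeasurableSpace B] (μ : Measure Ω) (X : Ω → B) (κ : Ω → Measure B) : Prop where
  prob : ∀ ω, IsProbabilityMeasure (κ ω)
  measurable : ∀ E, MeasurableSet E → Measurable[m] fun ω => κ ω E
  condLaw : IsCondLaw m μ X κ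

variable {Ω : Type*} [MeasurableSpace Ω]

/-- The information in the history of the first `k` episodes, that is in the transitions
`(s_h^j, a_h^j, s_{h+1}^j)` for `j < k` and `h < H`. -/
abbrev historyInfo (H : ℕ) (s : ℕ → ℕ → Ω → State d) (a : ℕ → ℕ → Ω → A) (k : ℕ) :
    MeasurableSpace Ω :=
  ⨆ j < k, ⨆ h < H, MeasurableSpace.comap
    (fun ω => (s j h ω, a j h ω, s j (h + 1) ω)) inferInstance

/-- Everything that was drawn before episode `k`: the true model, the models sampled in earlier
episodes, and the history. -/
abbrev pastInfo (H : ℕ) (fstar : Ω → F) (fs : ℕ → Ω → F) (s : ℕ → ℕ → Ω → State d)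
    (a : ℕ → ℕ → Ω → A) (k : ℕ) : MeasurableSpace Ω :=
  MeasurableSpace.comap fstar inferInstance ⊔
    (⨆ j < k, MeasurableSpace.comap (fs j) inferInstance) ⊔ historyInfo H s a k

/-- Everything that was drawn before the action of step `h` of episode `k`. -/
abbrev stepInfo (H : ℕ) (fstar : Ω → F) (fs : ℕ → Ω → F) (s : ℕ → ℕ → Ω → State d)
    (a : ℕ → ℕ → Ω → A) (k h : ℕ) : MeasurableSpace Ω :=
  pastInfo H fstar fs s a k ⊔ MeasurableSpace.comap (fs k) inferInstance ⊔
    (⨆ i ≤ h, MeasurableSpace.comap (s k i) inferInstance) ⊔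
    (⨆ i < h, MeasurableSpace.comap (a k i) inferInstance)

/-- A run of the Thompson-sampling algorithm. The true model `fstar` is drawn from the prior `P`.
Episode `k` samples the model `fs k` from the posterior of `fstar` given the history, starts in
`s k 0` drawn from `ρ`, and executes the policy planned for `fs k`. States evolve by `fstar` with
Gaussian noise. -/
structure IsThompsonRun (σ : ℝ) (H : ℕ) (ρ : Measure (State d)) (P : Measure F)
    (plan : ℕ → Kernel (F × State d) A) (μ : Measure Ω) (fstar : Ω → F)
    (post : ℕ → Ω → Measure F) (fs : ℕ → Ω → F) (s : ℕ → ℕ → Ω → State d)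
    (a : ℕ → ℕ → Ω → A) : Prop where
  measurable_fstar : Measurable fstar
  measurable_fs : ∀ k, Measurable (fs k)
  measurable_s : ∀ k h, Measurable (s k h)
  measurable_a : ∀ k h, Measurable (a k h)
  prior : μ.map fstar = P
  posterior : ∀ k, IsPosterior (historyInfo H s a k) μ fstar (post k)
  sample : ∀ k, IsCondLaw (pastInfo H fstar fs s a k) μ (fs k) (post k)
  init : ∀ k, IsCondLaw
    (pastInfo H fstar fs s a k ⊔ MeasurableSpace.comap (fs k) inferInstance) μ (s k 0) fun _ => ρ
  action : ∀ k, ∀ h < H, IsCondLaw (stepInfo H fstar fs s a k h) μ (a k h)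
    fun ω => plan h (fs k ω, s k h ω)
  step : ∀ k, ∀ h < H, IsCondLaw
    (stepInfo H fstar fs s a k h ⊔ MeasurableSpace.comap (a k h) inferInstance) μ (s k (h + 1))
    fun ω => transition σ ((fstar ω).1 (s k h ω) (a k h ω))

/-- The regret of the first `K` episodes, as a random variable:
`∑_k (V_0^*(s_0^k) - V_0^{π_k}(s_0^k))`, with values under the true model. -/
def regret (σ : ℝ) (r : State d → A → ℝ) (H : ℕ) (plan : ℕ → Kernel (F × State d) A)
    [∀ h, IsMarkovKernel (plan h)] (fstar : Ω → F) (fs : ℕ → Ω → F)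
    (s : ℕ → ℕ → Ω → State d) (K : ℕ) (ω : Ω) : ℝ :=
  ∑ k ∈ Finset.range K,
    (optValue σ r H (fstar ω).1 (s k 0 ω)
      - value σ r H (fstar ω).1 (plannedPolicy plan (fs k ω)) (s k 0 ω))

end Algorithm

end

end SPEDE

/-! Given the history, the sampled model f_k and the true model f* have the same law, and the
initial state is drawn independently of both. So the expected optimal value of f* equals that of
f_k, which by dynamic programming is the value of π_k in f_k (`IsThompsonRun.map_init_eq`,
`optValue_eq_planV`). No optimism is needed: the expected regret of an episode compares one policy
in two models. Telescoping along the run, each step costs at most Hκ‖f_k − f*‖ at the visited pair,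
because expectations of a function with values in [0, H] under two Gaussians differ by a multiple of
the distance of the means (`integral_transition_sub_le`).

It remains to sum the model errors. An exponential martingale and a union bound over a finite
T^{-1/2}-net show that the residuals of f* are nearly uncorrelated with every direction from f* to
the net. This is a property of the pair (history, function), so posterior sampling gives it to f_k
with the same probability. Two functions with this property are close on the data
(`dataGap_le_of_typical`): the squared gap is at most β, of order log|N| + log T, outside an event
of probability 1/T. No least-squares estimator or confidence set enters.

For such episodes the eluder dimension D limits the number of errors above η to (β/η² + H)D
(`card_large_le`); the term HD arises because the model is updated only between episodes. Dyadic
summation from scale ε gives Tε + 2βD/ε + O(HD), and ε = √(βD/T) gives 3√(βDT) + O(HD). If K ≤ HD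
the trivial bound KH on the regret suffices; otherwise HD is at most √(TD) and is absorbed. -/

namespace SPEDE

/-! ### Likelihood ratios of Gaussians with a common covariance -/

section Gaussian

variable {d : ℕ} {σ : ℝ}

/-- The logarithm of the likelihood ratio of `N(m₁, σ² I)` with respect to `N(m₂, σ² I)`. -/
noncomputable def logRatio (σ : ℝ) (m₁ m₂ y : State d) : ℝ :=
  (‖m₂ - y‖ ^ 2 - ‖m₁ - y‖ ^ 2) / (2 * σ ^ 2)

lemma continuous_gaussKernel : Continuous fun p : State d × State d => gaussKernel σ p.1 p.2 := by
  unfold gaussKernel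
  fun_prop

lemma isProbabilityMeasure_transition (hσ : 0 < σ) (m : State d) :
    IsProbabilityMeasure (transition σ m) := by
  constructor
  have hb : 0 < 1 / (2 * σ ^ 2) := by positivity
  have h1 := GaussianFourier.integral_rexp_neg_mul_sq_norm (V := State d) hb
  have h2 : ∫ y : State d, gaussKernel σ m y = (2 * Real.pi * σ ^ 2) ^ ((d : ℝ) / 2) := by
    have h3 := integral_sub_left_eq_self (fun v : State d => Real.exp (-(1 / (2 * σ ^ 2)) * ‖v‖ ^ 2))
      volume m
    rw [h1] at h3
    have h4 : ∀ y : State d, gaussKernel σ m y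
        = Real.exp (-(1 / (2 * σ ^ 2)) * ‖m - y‖ ^ 2) := by
      intro y; unfold gaussKernel; congr 1; ring
    simp_rw [h4]
    rw [h3]
    congr 1
    · field_simp
    · simp
  have hpos : 0 < (2 * Real.pi * σ ^ 2) ^ ((d : ℝ) / 2) := by positivity
  have hint : Integrable (fun y : State d => gaussKernel σ m y) := by
    by_contra hcon
    -- The integral of a non-integrable function is 0 by convention, so a positive value forces
    -- integrability.
    rw [integral_undef hcon] at h2
    exact hpos.ne h2
  rw [transition, withDensity_apply _ MeasurableSet.univ, Measure.restrict_univ,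
    ← ofReal_integral_eq_lintegral_ofReal (hint.const_mul _)
      (Filter.Eventually.of_forall fun y => by unfold gaussKernel; positivity),
    integral_const_mul, h2, ← Real.rpow_add (by positivity)]
  have : -(d : ℝ) / 2 + (d : ℝ) / 2 = 0 := by ring
  simp [this]

lemma continuous_logRatio (m₁ m₂ : State d) : Continuous (logRatio σ m₁ m₂) := by
  unfold logRatio
  fun_prop

lemma transition_eq_withDensity (m₁ m₂ : State d) :
    transition σ m₁ =
      (transition σ m₂).withDensity fun y => ENNReal.ofReal (Real.exp (logRatio σ m₁ m₂ y)) := by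
  unfold transition
  have hm : Measurable fun y : State d => gaussKernel σ m₂ y :=
    (continuous_gaussKernel.comp (Continuous.prodMk_right m₂)).measurable
  rw [← withDensity_mul _ ((hm.const_mul _).ennreal_ofReal)
    ((continuous_logRatio m₁ m₂).measurable.exp.ennreal_ofReal)]
  congr 1
  ext y
  have h : gaussKernel σ m₁ y = gaussKernel σ m₂ y * Real.exp (logRatio σ m₁ m₂ y) := by
    unfold gaussKernel logRatio
    rw [← Real.exp_add]
    congr 1
    ring
  rw [Pi.mul_apply, ← ENNReal.ofReal_mul' (Real.exp_pos _).le]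
  rw [h, mul_assoc (_ ^ _)]

/-- Every exponential moment used below reduces to this one: it is the total mass of the Gaussian
centred at `m₁`. -/
lemma lintegral_exp_logRatio (hσ : 0 < σ) (m₁ m₂ : State d) :
    ∫⁻ y, ENNReal.ofReal (Real.exp (logRatio σ m₁ m₂ y)) ∂(transition σ m₂) = 1 := by
  have := isProbabilityMeasure_transition hσ m₁
  have h : transition σ m₁ Set.univ = 1 := measure_univ
  rwa [transition_eq_withDensity m₁ m₂, withDensity_apply _ MeasurableSet.univ,
    Measure.restrict_univ] at h

lemma integrable_exp_logRatio (hσ : 0 < σ) (m₁ m₂ : State d) :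
    Integrable (fun y => Real.exp (logRatio σ m₁ m₂ y)) (transition σ m₂) := by
  refine ⟨(continuous_logRatio m₁ m₂).measurable.exp.aestronglyMeasurable, ?_⟩
  rw [hasFiniteIntegral_iff_ofReal (Filter.Eventually.of_forall fun y => (Real.exp_pos _).le),
    lintegral_exp_logRatio hσ]
  exact ENNReal.one_lt_top

lemma integral_exp_logRatio (hσ : 0 < σ) (m₁ m₂ : State d) :
    ∫ y, Real.exp (logRatio σ m₁ m₂ y) ∂(transition σ m₂) = 1 := by
  rw [integral_eq_lintegral_of_nonneg_ae
    (Filter.Eventually.of_forall fun y => (Real.exp_pos _).le)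
    (continuous_logRatio m₁ m₂).measurable.exp.aestronglyMeasurable,
    lintegral_exp_logRatio hσ, ENNReal.toReal_one]

/-- Completing the square: the square is again a likelihood ratio, for the reflected mean 2m₁ − m₂,
up to a constant. Hence the second moment of the likelihood ratio is exactly exp(‖m₁ − m₂‖²/σ²). -/
lemma exp_logRatio_sq (hσ : 0 < σ) (m₁ m₂ y : State d) :
    Real.exp (logRatio σ m₁ m₂ y) ^ 2 =
      Real.exp (‖m₁ - m₂‖ ^ 2 / σ ^ 2) *
        Real.exp (logRatio σ ((2 : ℝ) • m₁ - m₂) m₂ y) := by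
  rw [← Real.exp_add, ← Real.exp_nat_mul]
  congr 1
  unfold logRatio
  have e1 : (2 : ℝ) • m₁ - m₂ - y = (m₁ - y) + (m₁ - m₂) := by module
  have e2 : m₂ - y = (m₁ - y) - (m₁ - m₂) := by module
  rw [e1, e2, norm_add_sq_real, norm_sub_sq_real]
  field_simp
  push_cast
  ring

/-- A total variation bound: expectations of a bounded function under two Gaussians differ by at
most a multiple of the distance between the means. -/
lemma integral_transition_sub_le (hσ : 0 < σ) {R : ℝ} {m₁ m₂ : State d}
    (hR : ‖m₁ - m₂‖ ≤ R) {V : State d → ℝ} (hV : Measurable V) {b : ℝ}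
    (hV0 : ∀ y, 0 ≤ V y) (hVb : ∀ y, V y ≤ b) :
    ∫ y, V y ∂(transition σ m₁) - ∫ y, V y ∂(transition σ m₂) ≤
      b * ((Real.exp (R ^ 2 / σ ^ 2) + 1) / (2 * σ)) * ‖m₁ - m₂‖ := by
  have hp1 := isProbabilityMeasure_transition hσ m₁
  have hp2 := isProbabilityMeasure_transition hσ m₂
  have hb : 0 ≤ b := (hV0 0).trans (hVb 0)
  rcases eq_or_ne m₁ m₂ with rfl | hne
  · simp
  set u := ‖m₁ - m₂‖ with hu
  have hupos : 0 < u := norm_pos_iff.2 (sub_ne_zero.2 hne)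
  set l := fun y => Real.exp (logRatio σ m₁ m₂ y) with hl
  have hlm : Measurable l := (continuous_logRatio m₁ m₂).measurable.exp
  have hli : Integrable l (transition σ m₂) := integrable_exp_logRatio hσ m₁ m₂
  have hl1 : ∫ y, l y ∂(transition σ m₂) = 1 := integral_exp_logRatio hσ m₁ m₂
  have hl2e : ∀ y, l y ^ 2 = Real.exp (u ^ 2 / σ ^ 2) *
        Real.exp (logRatio σ ((2 : ℝ) • m₁ - m₂) m₂ y) := exp_logRatio_sq hσ m₁ m₂
  have hl2i : Integrable (fun y => l y ^ 2) (transition σ m₂) := by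
    simp_rw [hl2e]
    exact (integrable_exp_logRatio hσ _ m₂).const_mul _
  have hl2 : ∫ y, l y ^ 2 ∂(transition σ m₂) = Real.exp (u ^ 2 / σ ^ 2) := by
    simp_rw [hl2e]
    rw [integral_const_mul, integral_exp_logRatio hσ, mul_one]
  have hVl : ∫ y, V y ∂(transition σ m₁) = ∫ y, l y * V y ∂(transition σ m₂) := by
    rw [transition_eq_withDensity m₁ m₂, integral_withDensity_eq_integral_toReal_smul
      hlm.ennreal_ofReal (Filter.Eventually.of_forall fun _ => ENNReal.ofReal_lt_top)]
    refine integral_congr_ae (Filter.Eventually.of_forall fun y => ?_)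
    simp only [smul_eq_mul]
    rw [ENNReal.toReal_ofReal (Real.exp_pos _).le]
  have hVbound : ∀ y, ‖V y‖ ≤ b := fun y => by
    rw [Real.norm_of_nonneg (hV0 y)]; exact hVb y
  have hVi : Integrable V (transition σ m₂) :=
    Integrable.of_bound hV.aestronglyMeasurable b (Filter.Eventually.of_forall hVbound)
  have hlVi : Integrable (fun y => l y * V y) (transition σ m₂) := by
    have := hli.bdd_mul hV.aestronglyMeasurable (Filter.Eventually.of_forall hVbound)
    simpa [mul_comm] using this
  rw [hVl, ← integral_sub hlVi hVi]
  -- By the arithmetic-geometric mean inequality |l − 1| ≤ (t/2)(l − 1)² + 1/(2t). The expectation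
  -- of (l − 1)² is of order u²/σ², so t = σ/u makes both terms linear in u.
  set t : ℝ := σ / u with ht
  have htpos : 0 < t := div_pos hσ hupos
  have hpt : ∀ y, l y * V y - V y ≤ b * ((t / 2) * (l y ^ 2 - 2 * l y + 1) + 1 / (2 * t)) := by
    intro y
    have h1 : |l y - 1| ≤ (t / 2) * (l y ^ 2 - 2 * l y + 1) + 1 / (2 * t) := by
      have h2 : (t / 2) * (l y ^ 2 - 2 * l y + 1) + 1 / (2 * t) - |l y - 1|
          = (t * |l y - 1| - 1) ^ 2 / (2 * t) := by
        have h3 : l y ^ 2 - 2 * l y + 1 = |l y - 1| ^ 2 := by rw [sq_abs]; ring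
        rw [h3]
        field_simp
        ring
      have h4 : 0 ≤ (t * |l y - 1| - 1) ^ 2 / (2 * t) := by positivity
      linarith
    calc l y * V y - V y = V y * (l y - 1) := by ring
      _ ≤ V y * |l y - 1| := mul_le_mul_of_nonneg_left (le_abs_self _) (hV0 y)
      _ ≤ b * |l y - 1| := mul_le_mul_of_nonneg_right (hVb y) (abs_nonneg _)
      _ ≤ _ := mul_le_mul_of_nonneg_left h1 hb
  have hi1 : Integrable (fun y => l y ^ 2 - 2 * l y) (transition σ m₂) :=
    hl2i.sub (hli.const_mul 2)
  have hi2 : Integrable (fun y => l y ^ 2 - 2 * l y + 1) (transition σ m₂) :=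
    hi1.add (integrable_const 1)
  have hi3 : Integrable (fun y => (t / 2) * (l y ^ 2 - 2 * l y + 1) + 1 / (2 * t))
      (transition σ m₂) := (hi2.const_mul _).add (integrable_const _)
  refine (integral_mono (hlVi.sub hVi) (hi3.const_mul b) hpt).trans ?_
  rw [integral_const_mul, integral_add (hi2.const_mul _) (integrable_const _),
    integral_const_mul, integral_add hi1 (integrable_const _),
    integral_sub hl2i (hli.const_mul 2), integral_const_mul, hl1, hl2]
  simp only [integral_const, probReal_univ, smul_eq_mul, one_mul, mul_one]
  rw [mul_assoc]
  refine mul_le_mul_of_nonneg_left ?_ hb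
  set M := Real.exp (R ^ 2 / σ ^ 2) with hM
  -- From 1 − x ≤ exp(−x) follows exp x − 1 ≤ x exp x; the bound `R` on u then makes the factor exp
  -- x uniform.
  have hx : Real.exp (u ^ 2 / σ ^ 2) - 1 ≤ (u ^ 2 / σ ^ 2) * M := by
    have h1 : Real.exp (u ^ 2 / σ ^ 2) ≤ M := by
      rw [hM, Real.exp_le_exp]
      gcongr
    have h2 := Real.add_one_le_exp (-(u ^ 2 / σ ^ 2))
    have h3 : Real.exp (u ^ 2 / σ ^ 2) * Real.exp (-(u ^ 2 / σ ^ 2)) = 1 := by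
      rw [← Real.exp_add]; simp
    have h5 : 0 ≤ u ^ 2 / σ ^ 2 := by positivity
    nlinarith [Real.exp_pos (u ^ 2 / σ ^ 2)]
  have hx' : t / 2 * (Real.exp (u ^ 2 / σ ^ 2) - 2 + 1) + 1 / (2 * t)
      ≤ t / 2 * ((u ^ 2 / σ ^ 2) * M) + 1 / (2 * t) := by
    have : Real.exp (u ^ 2 / σ ^ 2) - 2 + 1 ≤ (u ^ 2 / σ ^ 2) * M := by linarith
    gcongr
  refine hx'.trans (le_of_eq ?_)
  rw [ht]
  field_simp

/-- The exponential moment that drives the concentration of the noise. -/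
lemma lintegral_exp_inner (hσ : 0 < σ) (m v : State d) :
    ∫⁻ y, ENNReal.ofReal (Real.exp (inner ℝ (y - m) v / (2 * σ ^ 2) - ‖v‖ ^ 2 / (8 * σ ^ 2)))
      ∂(transition σ m) = 1 := by
  -- The integrand is the likelihood ratio for a shift of the mean by v/2.
  rw [← lintegral_exp_logRatio hσ (m + (1 / 2 : ℝ) • v) m]
  refine lintegral_congr fun y => ?_
  congr 2
  unfold logRatio
  have e1 : m + (1 / 2 : ℝ) • v - y = (m - y) + (1 / 2 : ℝ) • v := by module
  have e2 : y - m = -(m - y) := by module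
  rw [e1, norm_add_sq_real, e2, inner_neg_left, inner_smul_right, norm_smul]
  norm_num
  field_simp
  ring

lemma measurable_transition : Measurable (transition (d := d) σ) := by
  refine Measure.measurable_of_measurable_coe _ fun E hE => ?_
  have : ∀ m : State d, transition σ m E = ∫⁻ y in E, ENNReal.ofReal
      ((2 * Real.pi * σ ^ 2) ^ (-(d : ℝ) / 2) * gaussKernel σ m y) := fun m => by
    rw [transition, withDensity_apply _ hE]
  simp_rw [this]
  exact Measurable.lintegral_prod_right
    (continuous_gaussKernel.measurable.const_mul _).ennreal_ofReal

end Gaussian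

/-! ### The eluder dimension and the number of large errors -/

section Eluder

variable {d : ℕ} {A : Type*}

/-- The least colour `m` such that `i` is independent, in the sense of `Ind`, of the elements of
`S` below `i` that have colour `m`. -/
noncomputable def greedyColor (S : Finset ℕ) (Ind : Finset ℕ → ℕ → Prop) (i : ℕ) : ℕ :=
  open Classical in
  sInf {m : ℕ | Ind ((Finset.univ.filter fun j : Fin i =>
    (j : ℕ) ∈ S ∧ greedyColor S Ind j = m).map Fin.valEmbedding) i}
termination_by i
decreasing_by all_goals exact Fin.is_lt _

/-- Predecessors indexed by `Fin i` serve only the termination of the recursion; the form with a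
filter of `S` is the usable one. -/
lemma greedyColor_eq (S : Finset ℕ) (Ind : Finset ℕ → ℕ → Prop) (i : ℕ) :
    greedyColor S Ind i = sInf {m : ℕ | Ind (S.filter fun j =>
      j < i ∧ greedyColor S Ind j = m) i} := by
  classical
  rw [greedyColor]
  congr 1
  ext m
  rw [Set.mem_ofPred_eq, Set.mem_ofPred_eq]
  have : ((Finset.univ.filter fun j : Fin i =>
      (j : ℕ) ∈ S ∧ greedyColor S Ind j = m).map Fin.valEmbedding)
      = S.filter fun j => j < i ∧ greedyColor S Ind j = m := by
    ext j
    simp only [Finset.mem_map, Finset.mem_filter, Finset.mem_univ, true_and,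
      Fin.valEmbedding_apply]
    constructor
    · rintro ⟨j, ⟨h1, h2⟩, rfl⟩
      exact ⟨h1, j.2, h2⟩
    · rintro ⟨h1, h2, h3⟩
      exact ⟨⟨j, h2⟩, ⟨h1, h3⟩, rfl⟩
  rw [← this]

/-- An infimum of naturals is attained once some colour is admissible, and a colour unused on `S`
is: its class is empty. -/
lemma greedyColor_spec {S : Finset ℕ} {Ind : Finset ℕ → ℕ → Prop} {i : ℕ} (h : Ind ∅ i) :
    Ind (S.filter fun j => j < i ∧ greedyColor S Ind j = greedyColor S Ind i) i ∧
      ∀ m < greedyColor S Ind i, ¬ Ind (S.filter fun j => j < i ∧ greedyColor S Ind j = m) i := by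
  classical
  have hne : {m : ℕ | Ind (S.filter fun j => j < i ∧ greedyColor S Ind j = m) i}.Nonempty := by
    obtain ⟨m, hm⟩ := Infinite.exists_notMem_finset (S.image (greedyColor S Ind))
    refine ⟨m, ?_⟩
    have : (S.filter fun j => j < i ∧ greedyColor S Ind j = m) = ∅ := by
      refine Finset.filter_eq_empty_iff.2 fun j hj hcon => hm ?_
      exact Finset.mem_image.2 ⟨j, hj, hcon.2⟩
    rw [Set.mem_ofPred_eq, this]
    exact h
  have hs := Nat.sInf_mem hne
  rw [← greedyColor_eq] at hs
  refine ⟨hs, fun m hm hcon => ?_⟩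
  have : greedyColor S Ind i ≤ m := by
    rw [greedyColor_eq S Ind i]
    exact Nat.sInf_le hcon
  omega

/-- `x i` is `ε`-independent of the `x j` with `j ∈ B`. -/
def IndepAt (F : Set (State d → A → State d)) (ε : ℝ) (x : ℕ → State d × A) (B : Finset ℕ)
    (i : ℕ) : Prop :=
  ∃ f ∈ F, ∃ g ∈ F, Real.sqrt (∑ j ∈ B, ‖f (x j).1 (x j).2 - g (x j).1 (x j).2‖ ^ 2) ≤ ε ∧
    ε < ‖f (x i).1 (x i).2 - g (x i).1 (x i).2‖

/-- Enumerating `B` in increasing order turns the earlier elements of `B` into the predecessors in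
the sequence. -/
lemma hasEluderSequence_card {F : Set (State d → A → State d)} {α ε : ℝ} (hα : α ≤ ε)
    (x : ℕ → State d × A) (B : Finset ℕ)
    (h : ∀ i ∈ B, IndepAt F ε x (B.filter fun j => j < i) i) :
    HasEluderSequence F α B.card := by
  classical
  set e := B.orderEmbOfFin rfl with he
  -- The value `x 0` beyond the length is a filler that is never tested.
  refine ⟨ε, hα, fun l => if hl : l < B.card then x (e ⟨l, hl⟩) else x 0, fun i hi => ?_⟩
  obtain ⟨f, hf, g, hg, h1, h2⟩ := h (e ⟨i, hi⟩) (B.orderEmbOfFin_mem rfl _)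
  intro hdep
  have hlt := hdep f hf g hg
  simp only [hi, dif_pos] at hlt
  refine absurd (hlt ?_) (not_le.2 h2)
  refine le_trans (le_of_eq ?_) h1
  congr 1
  refine Finset.sum_bij (fun (j : Fin i) _ => e ⟨j, j.2.trans hi⟩) ?_ ?_ ?_ ?_
  · intro j _
    exact Finset.mem_filter.2 ⟨B.orderEmbOfFin_mem rfl _, e.lt_iff_lt.2 j.2⟩
  · intro a _ b _ hab
    have := e.injective hab
    simpa [Fin.ext_iff] using this
  · intro b hb
    obtain ⟨hb1, hb2⟩ := Finset.mem_filter.1 hb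
    have : b ∈ Set.range e := by rw [he, Finset.range_orderEmbOfFin]; exact hb1
    obtain ⟨l, rfl⟩ := this
    have hl : l < (⟨i, hi⟩ : Fin B.card) := e.lt_iff_lt.1 hb2
    exact ⟨⟨l, hl⟩, Finset.mem_univ _, rfl⟩
  · intro j _
    have : (j : ℕ) < B.card := j.2.trans hi
    simp [this]

/-- Large errors are rare: the number of times at which two functions, which agree up to `β` on the
data of all earlier episodes, differ by more than `ε`. -/
lemma card_large_le {F : Set (State d → A → State d)} {α ε β : ℝ} (hε : 0 < ε) (hα : α ≤ ε)
    (hβ : 0 ≤ β)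
    {D : ℕ} (hD : ∀ n, HasEluderSequence F α n → n ≤ D) {H : ℕ} (hH : 1 ≤ H)
    (x : ℕ → State d × A) (p q : ℕ → State d → A → State d) (hp : ∀ k, p k ∈ F)
    (hq : ∀ k, q k ∈ F) (S : Finset ℕ)
    (hS : ∀ i ∈ S, ε < ‖p (i / H) (x i).1 (x i).2 - q (i / H) (x i).1 (x i).2‖)
    (hgood : ∀ i ∈ S, ∑ j ∈ Finset.range (i / H * H),
      ‖p (i / H) (x j).1 (x j).2 - q (i / H) (x j).1 (x j).2‖ ^ 2 ≤ β) :
    (S.card : ℝ) ≤ (β / ε ^ 2 + H) * D := by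
  classical
  -- Each element of `S` enters the first class of which it is independent. A class is then an
  -- eluder sequence, so it has at most `D` elements, and it remains to bound the number of classes.
  set c := greedyColor S (IndepAt F ε x) with hc
  have hspec : ∀ i ∈ S, IndepAt F ε x (S.filter fun j => j < i ∧ c j = c i) i ∧
      ∀ m < c i, ¬ IndepAt F ε x (S.filter fun j => j < i ∧ c j = m) i := fun i hi =>
    greedyColor_spec ⟨p (i / H), hp _, q (i / H), hq _, by simp [hε.le], hS i hi⟩
  have hclass : ∀ m ∈ S.image c, (S.filter fun j => c j = m).card ≤ D := by
    intro m _
    refine hD _ (hasEluderSequence_card hα x _ fun i hi => ?_)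
    obtain ⟨hi1, hi2⟩ := Finset.mem_filter.1 hi
    have := (hspec i hi1).1
    rw [Finset.filter_filter]
    simpa only [hi2, and_comm] using this
  -- The element i depends on every lower class although its own error exceeds ε. So the two
  -- functions of its episode have squared gap above ε² on each lower class; the classes are
  -- disjoint and the total gap on earlier episodes is at most β.
  have hcol : ∀ i ∈ S, (c i : ℝ) + 1 ≤ β / ε ^ 2 + H := by
    intro i hi
    set k := i / H with hk
    set φ : ℕ → ℝ := fun j => ‖p k (x j).1 (x j).2 - q k (x j).1 (x j).2‖ ^ 2 with hφ
    -- Colours met earlier in the current episode are discarded, since `hgood` controls only the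
    -- episodes before it. At most H − 1 indices of the episode precede i.
    set U := Finset.range (c i) \ (Finset.Ico (k * H) i).image c with hU
    have hkH : k * H ≤ i := Nat.div_mul_le_self i H
    have hiH : i < k * H + H := by
      have := Nat.div_add_mod i H
      have h2 := Nat.mod_lt i hH
      rw [hk, mul_comm]
      omega
    have hUcard : c i ≤ U.card + (H - 1) := by
      have h1 : (Finset.range (c i)).card - ((Finset.Ico (k * H) i).image c).card ≤ U.card :=
        Finset.le_card_sdiff _ _
      have h2 : ((Finset.Ico (k * H) i).image c).card ≤ (Finset.Ico (k * H) i).card :=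
        Finset.card_image_le
      rw [Nat.card_Ico] at h2
      rw [Finset.card_range] at h1
      omega
    -- For a colour in `U` all predecessors of i lie in earlier episodes. The sum on the right also
    -- admits indices outside `S`, which only enlarges it.
    have hlow : ∀ m ∈ U, ε ^ 2 ≤ ∑ j ∈ (Finset.range (k * H)).filter (fun j => c j = m), φ j := by
      intro m hm
      obtain ⟨hm1, hm2⟩ := Finset.mem_sdiff.1 hm
      have hni := (hspec i hi).2 m (Finset.mem_range.1 hm1)
      have h1 : ε < Real.sqrt (∑ j ∈ S.filter (fun j => j < i ∧ c j = m), φ j) := by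
        by_contra hcon
        exact hni ⟨p k, hp k, q k, hq k, not_lt.1 hcon, hS i hi⟩
      have h2 : ε ^ 2 < ∑ j ∈ S.filter (fun j => j < i ∧ c j = m), φ j :=
        (Real.lt_sqrt hε.le).1 h1
      refine h2.le.trans (Finset.sum_le_sum_of_subset_of_nonneg ?_ fun j _ _ => sq_nonneg _)
      intro j hj
      obtain ⟨_, hj2, hj3⟩ := Finset.mem_filter.1 hj
      refine Finset.mem_filter.2 ⟨Finset.mem_range.2 ?_, hj3⟩
      by_contra hcon
      exact hm2 (Finset.mem_image.2 ⟨j, Finset.mem_Ico.2 ⟨not_lt.1 hcon, hj2⟩, hj3⟩)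
    have hsum : (U.card : ℝ) * ε ^ 2 ≤ β := by
      calc (U.card : ℝ) * ε ^ 2 = ∑ m ∈ U, ε ^ 2 := by simp
        _ ≤ ∑ m ∈ U, ∑ j ∈ (Finset.range (k * H)).filter (fun j => c j = m), φ j :=
          Finset.sum_le_sum hlow
        _ = ∑ j ∈ (Finset.range (k * H)).filter (fun j => c j ∈ U), φ j := by
          rw [← Finset.sum_fiberwise_of_maps_to (t := U) (g := c)
            (fun j hj => (Finset.mem_filter.1 hj).2)]
          refine Finset.sum_congr rfl fun m hm => ?_
          rw [Finset.filter_filter]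
          refine Finset.sum_congr ?_ fun _ _ => rfl
          ext j
          simp only [Finset.mem_filter]
          constructor
          · rintro ⟨h1, rfl⟩; exact ⟨h1, hm, rfl⟩
          · rintro ⟨h1, _, h3⟩; exact ⟨h1, h3⟩
        _ ≤ ∑ j ∈ Finset.range (k * H), φ j :=
          Finset.sum_le_sum_of_subset_of_nonneg (Finset.filter_subset _ _)
            fun j _ _ => sq_nonneg _
        _ ≤ β := hgood i hi
    have h3 : (U.card : ℝ) ≤ β / ε ^ 2 := by rwa [le_div_iff₀ (by positivity)]
    have h4 : (c i : ℝ) + 1 ≤ U.card + H := by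
      have : c i + 1 ≤ U.card + H := by omega
      exact_mod_cast this
    linarith
  have hcard : S.card ≤ D * (S.image c).card := Finset.card_le_mul_card_image S D hclass
  have hcolors : ((S.image c).card : ℝ) ≤ β / ε ^ 2 + H := by
    have h0 : 0 ≤ β / ε ^ 2 + H := by positivity
    have hsub : S.image c ⊆ Finset.range ⌊β / ε ^ 2 + H⌋₊ := by
      intro m hm
      obtain ⟨i, hi, rfl⟩ := Finset.mem_image.1 hm
      rw [Finset.mem_range]
      refine Nat.lt_of_succ_le (Nat.le_floor ?_)
      push_cast
      exact hcol i hi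
    have := Finset.card_le_card hsub
    rw [Finset.card_range] at this
    exact (Nat.cast_le.2 this).trans (Nat.floor_le h0)
  calc (S.card : ℝ) ≤ D * (S.image c).card := by exact_mod_cast hcard
    _ ≤ D * (β / ε ^ 2 + H) := by gcongr
    _ = _ := mul_comm _ _

/-- Summation over dyadic scales of a bound on the number of large values. -/
lemma sum_le_of_card_large_le {n : ℕ} {w : ℕ → ℝ} {R ε b h : ℝ} (hε : 0 < ε) (hb : 0 ≤ b)
    (hh : 0 ≤ h) (hR : 0 ≤ R) (hwR : ∀ i < n, w i ≤ R)
    (hcard : ∀ η, ε ≤ η → (((Finset.range n).filter fun i => η < w i).card : ℝ) ≤ b / η ^ 2 + h) :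
    ∑ i ∈ Finset.range n, w i ≤ n * ε + 2 * b / ε + 2 * R * h := by
  classical
  -- The least such number of scales is taken: minimality bounds the largest scale by R, so that the
  -- scales sum to at most 2R.
  have hex : ∃ L : ℕ, R ≤ 2 ^ L * ε := by
    obtain ⟨L, hL⟩ := pow_unbounded_of_one_lt (R / ε) (one_lt_two)
    exact ⟨L, ((div_lt_iff₀ hε).1 hL).le⟩
  set L := Nat.find hex with hLdef
  have hL : R ≤ 2 ^ L * ε := Nat.find_spec hex
  have hLmin : ∀ l < L, 2 ^ l * ε < R := fun l hl => not_le.1 (Nat.find_min hex hl)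
  -- If 2^M ε is the largest scale below v, the smaller scales are below v too, and ε plus all of
  -- them is 2^(M+1) ε ≥ v.
  have hpt : ∀ M : ℕ, ∀ v : ℝ, v ≤ 2 ^ M * ε →
      v ≤ ε + ∑ l ∈ Finset.range M, if 2 ^ l * ε < v then 2 ^ l * ε else 0 := by
    intro M
    induction M with
    | zero => intro v hv; simpa using hv
    | succ M ih =>
      intro v hv
      rw [Finset.sum_range_succ]
      by_cases hvM : 2 ^ M * ε < v
      · have h1 : ∀ l ∈ Finset.range M, (if 2 ^ l * ε < v then 2 ^ l * ε else 0) = 2 ^ l * ε := by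
          intro l hl
          rw [if_pos]
          refine lt_of_le_of_lt ?_ hvM
          have := (Finset.mem_range.1 hl).le
          gcongr
          norm_num
        rw [Finset.sum_congr rfl h1, if_pos hvM, ← Finset.sum_mul, geom_sum_eq (by norm_num)]
        rw [pow_succ] at hv
        have : ((2 : ℝ) ^ M - 1) / (2 - 1) = 2 ^ M - 1 := by norm_num
        rw [this]
        linarith
      · rw [if_neg hvM, add_zero]
        exact ih v (not_lt.1 hvM)
  have hgeom : ∑ l ∈ Finset.range L, (2 : ℝ) ^ l * ε ≤ 2 * R := by
    rcases Nat.eq_zero_or_pos L with h0 | hpos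
    · rw [h0]; simp [hR]
    · obtain ⟨M, hM⟩ : ∃ M, L = M + 1 := ⟨L - 1, by omega⟩
      have h1 := hLmin M (by omega)
      rw [← Finset.sum_mul, geom_sum_eq (by norm_num), hM, pow_succ]
      have : ((2 : ℝ) ^ M * 2 - 1) / (2 - 1) = 2 ^ M * 2 - 1 := by norm_num
      rw [this]
      nlinarith
  have hgeom' : ∑ l ∈ Finset.range L, ((1 : ℝ) / 2) ^ l ≤ 2 := by
    have := (summable_geometric_two).sum_le_tsum (Finset.range L) (fun i _ => by positivity)
    rwa [tsum_geometric_two] at this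
  calc ∑ i ∈ Finset.range n, w i
      ≤ ∑ i ∈ Finset.range n,
          (ε + ∑ l ∈ Finset.range L, if 2 ^ l * ε < w i then 2 ^ l * ε else 0) :=
        Finset.sum_le_sum fun i hi =>
          hpt L _ ((hwR i (Finset.mem_range.1 hi)).trans hL)
    _ = n * ε + ∑ l ∈ Finset.range L,
          2 ^ l * ε * (((Finset.range n).filter fun i => 2 ^ l * ε < w i).card : ℝ) := by
        rw [Finset.sum_add_distrib, Finset.sum_comm]
        congr 1
        · simp
        · refine Finset.sum_congr rfl fun l _ => ?_
          rw [← Finset.sum_filter, Finset.sum_const, nsmul_eq_mul, mul_comm]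
    -- At scale 2^l ε the count b/η² + h contributes one decreasing and one increasing geometric
    -- term, so the number of scales costs no logarithm.
    _ ≤ n * ε + ∑ l ∈ Finset.range L, (b / ε * (1 / 2) ^ l + 2 ^ l * ε * h) := by
        gcongr with l hl
        have h1 : ε ≤ 2 ^ l * ε := by
          have : (1 : ℝ) ≤ 2 ^ l := one_le_pow₀ (by norm_num)
          nlinarith
        refine (mul_le_mul_of_nonneg_left (hcard _ h1) (by positivity)).trans (le_of_eq ?_)
        rw [one_div, inv_pow]
        field_simp
    _ = n * ε + (b / ε * ∑ l ∈ Finset.range L, ((1 : ℝ) / 2) ^ l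
          + (∑ l ∈ Finset.range L, (2 : ℝ) ^ l * ε) * h) := by
        rw [Finset.sum_add_distrib, Finset.mul_sum, Finset.sum_mul]
    _ ≤ n * ε + (b / ε * 2 + 2 * R * h) := by gcongr
    _ = _ := by ring

end Eluder

/-! ### Measurable dependence of state laws and values on parameters -/

section Kernels

variable {d : ℕ} {A X Z : Type*} [MeasurableSpace A] [MeasurableSpace X] [MeasurableSpace Z]
  {σ : ℝ}

lemma integrable_of_abs_le {μ : Measure X} [IsFiniteMeasure μ] {ψ : X → ℝ} (hψ : Measurable ψ)
    {b : ℝ} (hb : ∀ x, |ψ x| ≤ b) : Integrable ψ μ :=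
  Integrable.of_bound hψ.aestronglyMeasurable b (Filter.Eventually.of_forall hb)

lemma abs_integral_le_of_abs_le {μ : Measure X} [IsProbabilityMeasure μ] {ψ : X → ℝ}
    {b : ℝ} (hb : ∀ x, |ψ x| ≤ b) : |∫ x, ψ x ∂μ| ≤ b := by
  have := norm_integral_le_of_norm_le_const (μ := μ) (f := ψ) (C := b)
    (Filter.Eventually.of_forall hb)
  simpa using this

lemma measurable_integral_kernel {κ : Kernel X Z} [IsSFiniteKernel κ] {ψ : X × Z → ℝ}
    (hψ : Measurable ψ) : Measurable fun x => ∫ z, ψ (x, z) ∂(κ x) :=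
  (hψ.stronglyMeasurable.integral_kernel_prod_right' (κ := κ)).measurable

lemma measurable_integral_kernel' {κ : Kernel X Z} [IsSFiniteKernel κ] {ψ : X → Z → ℝ}
    (hψ : Measurable fun p : X × Z => ψ p.1 p.2) : Measurable fun x => ∫ z, ψ x z ∂(κ x) :=
  measurable_integral_kernel hψ

lemma measurable_section {ψ : X → Z → ℝ} (hψ : Measurable fun p : X × Z => ψ p.1 p.2) (x : X) :
    Measurable (ψ x) :=
  Measurable.comp (g := fun p : X × Z => ψ p.1 p.2) hψ (measurable_prodMk_left (x := x))

lemma integral_snd_compProd {κ : Kernel X Z} {W : Type*} [MeasurableSpace W]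
    {η : Kernel (X × Z) W} [IsMarkovKernel κ] [IsMarkovKernel η] (x : X) {ψ : W → ℝ}
    (hψ : Measurable ψ) {b : ℝ} (hb : ∀ w, |ψ w| ≤ b) :
    ∫ w, ψ w ∂((κ ⊗ₖ η).snd x) = ∫ z, ∫ w, ψ w ∂(η (x, z)) ∂(κ x) := by
  rw [Kernel.snd_apply, integral_map measurable_snd.aemeasurable hψ.aestronglyMeasurable,
    ProbabilityTheory.integral_compProd]
  exact integrable_of_abs_le (hψ.comp measurable_snd) (fun w => hb w.2)

/-- The Gaussian transition kernel with measurable mean `φ`. -/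
noncomputable def transKer (σ : ℝ) (φ : X → State d) (hφ : Measurable φ) : Kernel X (State d) :=
  ⟨fun x => transition σ (φ x), measurable_transition.comp hφ⟩

lemma transKer_apply (φ : X → State d) (hφ : Measurable φ) (x : X) :
    transKer σ φ hφ x = transition σ (φ x) := rfl

lemma isMarkovKernel_transKer (hσ : 0 < σ) (φ : X → State d) (hφ : Measurable φ) :
    IsMarkovKernel (transKer σ φ hφ) :=
  ⟨fun x => isProbabilityMeasure_transition hσ (φ x)⟩

/-- The law of the state after `t` steps, as a kernel in the parameters `z` of the dynamics, the
policy and the initial state. -/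
noncomputable def lawKer (σ : ℝ) (φ : (Z × State d) × A → State d) (hφ : Measurable φ)
    (κ : ℕ → Kernel (Z × State d) A) (s : Z → State d) (hs : Measurable s) :
    ℕ → Kernel Z (State d)
  | 0 => Kernel.deterministic s hs
  | t + 1 => (lawKer σ φ hφ κ s hs t ⊗ₖ (κ t ⊗ₖ transKer σ φ hφ).snd).snd

lemma isMarkovKernel_lawKer (hσ : 0 < σ) (φ : (Z × State d) × A → State d) (hφ : Measurable φ)
    (κ : ℕ → Kernel (Z × State d) A) [∀ t, IsMarkovKernel (κ t)] (s : Z → State d)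
    (hs : Measurable s) (t : ℕ) : IsMarkovKernel (lawKer σ φ hφ κ s hs t) := by
  have := isMarkovKernel_transKer hσ φ hφ
  induction t with
  | zero => rw [lawKer]; infer_instance
  | succ t ih => rw [lawKer]; infer_instance

lemma snd_compProd_apply_eq_bind {κ : Kernel X Z} {W : Type*} [MeasurableSpace W]
    {η : Kernel (X × Z) W} [IsMarkovKernel κ] [IsMarkovKernel η] (x : X) :
    (κ ⊗ₖ η).snd x = (κ x).bind fun z => η (x, z) := by
  ext E hE
  have hm : Measurable fun z => η (x, z) := η.measurable.comp measurable_prodMk_left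
  rw [Measure.bind_apply hE hm.aemeasurable, Kernel.snd_apply' _ _ hE,
    Kernel.compProd_apply (measurable_snd hE)]
  rfl

/-- `stateLaw` is an iterated `bind` for one fixed model and policy. Writing it as a kernel in a
parameter gives joint measurability, needed because model, policy and initial state are random. -/
lemma lawKer_apply (hσ : 0 < σ) (φ : (Z × State d) × A → State d) (hφ : Measurable φ)
    (κ : ℕ → Kernel (Z × State d) A) [∀ t, IsMarkovKernel (κ t)] (s : Z → State d)
    (hs : Measurable s) (z : Z) {f : State d → A → State d} (hf : ∀ x a, φ ((z, x), a) = f x a)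
    {π : Policy d A} (hπ : ∀ t x, π.act t x = κ t (z, x)) (t : ℕ) :
    lawKer σ φ hφ κ s hs t z = stateLaw σ f π (s z) t := by
  have := isMarkovKernel_transKer hσ φ hφ
  have := fun t => isMarkovKernel_lawKer hσ φ hφ κ s hs t
  induction t with
  | zero => rw [lawKer, stateLaw, Kernel.deterministic_apply]
  | succ t ih =>
    rw [lawKer, snd_compProd_apply_eq_bind, ih, stateLaw]
    congr 1
    ext1 x
    rw [snd_compProd_apply_eq_bind, hπ]
    simp_rw [transKer_apply, hf]

lemma measurable_value (hσ : 0 < σ) (φ : (Z × State d) × A → State d) (hφ : Measurable φ)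
    (κ : ℕ → Kernel (Z × State d) A) [∀ t, IsMarkovKernel (κ t)] (s : Z → State d)
    (hs : Measurable s) {f : Z → State d → A → State d} (hf : ∀ z x a, φ ((z, x), a) = f z x a)
    {π : Z → Policy d A} (hπ : ∀ z t x, (π z).act t x = κ t (z, x))
    {r : State d → A → ℝ} (hr : Measurable (Function.uncurry r)) (H : ℕ) :
    Measurable fun z => value σ r H (f z) (π z) (s z) := by
  have := fun t => isMarkovKernel_lawKer hσ φ hφ κ s hs t
  unfold value
  refine Finset.measurable_sum _ fun t _ => ?_
  simp_rw [← fun z => lawKer_apply hσ φ hφ κ s hs z (hf z) (hπ z), hπ]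
  refine measurable_integral_kernel
    (ψ := fun p : Z × State d => ∫ a, r p.2 a ∂(κ t p)) ?_
  exact measurable_integral_kernel (ψ := fun q : (Z × State d) × A => r q.1.2 q.2)
    (hr.comp ((measurable_snd.comp measurable_fst).prodMk measurable_snd))

end Kernels

/-! ### Bellman verification of values -/

section Values

variable {d : ℕ} {A : Type*} [MeasurableSpace A] {σ : ℝ} {r : State d → A → ℝ}
  {f : State d → A → State d}

lemma isProbabilityMeasure_stateLaw (hσ : 0 < σ) (hf : Measurable (Function.uncurry f))
    (π : Policy d A) (s : State d) (t : ℕ) : IsProbabilityMeasure (stateLaw σ f π s t) := by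
  have := π.markov
  have hφ : Measurable fun p : (Unit × State d) × A => f p.1.2 p.2 :=
    hf.comp ((measurable_snd.comp measurable_fst).prodMk measurable_snd)
  have := isMarkovKernel_lawKer hσ _ hφ (fun t => (π.act t).comap Prod.snd measurable_snd)
    (fun _ => s) measurable_const t
  rw [← lawKer_apply hσ _ hφ (fun t => (π.act t).comap Prod.snd measurable_snd)
    (fun _ => s) measurable_const () (fun _ _ => rfl) (fun _ _ => rfl) t]
  infer_instance

lemma integral_stateLaw_succ (hσ : 0 < σ) (hf : Measurable (Function.uncurry f))
    (π : Policy d A) (s : State d) (t : ℕ) {ψ : State d → ℝ} (hψ : Measurable ψ) {b : ℝ}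
    (hb : ∀ x, |ψ x| ≤ b) :
    ∫ x, ψ x ∂(stateLaw σ f π s (t + 1)) =
      ∫ x, ∫ a, ∫ y, ψ y ∂(transition σ (f x a)) ∂(π.act t x) ∂(stateLaw σ f π s t) := by
  have := π.markov
  have hφ : Measurable fun p : (Unit × State d) × A => f p.1.2 p.2 :=
    hf.comp ((measurable_snd.comp measurable_fst).prodMk measurable_snd)
  have := fun t => isMarkovKernel_lawKer hσ _ hφ
    (fun t => (π.act t).comap Prod.snd measurable_snd) (fun _ => s) measurable_const t
  have := isMarkovKernel_transKer hσ _ hφ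
  have hl := lawKer_apply hσ _ hφ (fun t => (π.act t).comap Prod.snd measurable_snd)
    (fun _ => s) measurable_const () (f := f) (fun _ _ => rfl) (π := π) (fun _ _ => rfl)
  rw [← hl, ← hl, lawKer, integral_snd_compProd _ hψ hb]
  simp_rw [integral_snd_compProd _ hψ hb]
  rfl

lemma value_mem_Icc (hσ : 0 < σ) (hf : Measurable (Function.uncurry f))
    (hr01 : ∀ x a, r x a ∈ Set.Icc (0 : ℝ) 1) (π : Policy d A) (s : State d) (H : ℕ) :
    value σ r H f π s ∈ Set.Icc (0 : ℝ) H := by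
  have := π.markov
  have := isProbabilityMeasure_stateLaw hσ hf π s
  have hr' : ∀ x a, |r x a| ≤ 1 := fun x a => by
    rw [abs_of_nonneg (hr01 x a).1]; exact (hr01 x a).2
  constructor
  · exact Finset.sum_nonneg fun t _ => integral_nonneg fun x => integral_nonneg fun a => (hr01 x a).1
  · calc value σ r H f π s ≤ ∑ t ∈ Finset.range H, (1 : ℝ) := by
          refine Finset.sum_le_sum fun t _ => (le_abs_self _).trans ?_
          exact abs_integral_le_of_abs_le fun x => abs_integral_le_of_abs_le fun a => hr' x a
      _ = H := by simp

/-- One step of the expected reward plus the expected continuation value. -/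
lemma reward_add_continuation (hσ : 0 < σ) (hf : Measurable (Function.uncurry f))
    (hr : Measurable (Function.uncurry r)) (hr01 : ∀ x a, r x a ∈ Set.Icc (0 : ℝ) 1)
    (π : Policy d A) (s : State d) (t : ℕ) {ψ : State d → ℝ} (hψ : Measurable ψ) {b : ℝ}
    (hb : ∀ x, |ψ x| ≤ b) :
    (∫ x, ∫ a, r x a ∂(π.act t x) ∂(stateLaw σ f π s t)) + ∫ x, ψ x ∂(stateLaw σ f π s (t + 1)) =
      ∫ x, ∫ a, (r x a + ∫ y, ψ y ∂(transition σ (f x a))) ∂(π.act t x)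
        ∂(stateLaw σ f π s t) := by
  have := π.markov
  have := isProbabilityMeasure_stateLaw hσ hf π s
  have := isMarkovKernel_transKer hσ _ hf
  have := isProbabilityMeasure_transition (d := d) hσ
  have hr' : ∀ x a, |r x a| ≤ 1 := fun x a => by
    rw [abs_of_nonneg (hr01 x a).1]; exact (hr01 x a).2
  have hm : Measurable fun p : State d × A => ∫ y, ψ y ∂(transition σ (f p.1 p.2)) :=
    measurable_integral_kernel (κ := transKer σ _ hf) (ψ := fun q => ψ q.2)
      (hψ.comp measurable_snd)
  have hmb : ∀ p : State d × A, |∫ y, ψ y ∂(transition σ (f p.1 p.2))| ≤ b := fun p =>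
    abs_integral_le_of_abs_le hb
  have hrx : ∀ x, Measurable (r x) := measurable_section hr
  have hmx : ∀ x, Measurable fun a => ∫ y, ψ y ∂(transition σ (f x a)) := fun x =>
    measurable_section (ψ := fun x a => ∫ y, ψ y ∂(transition σ (f x a))) hm x
  have hr1 : Measurable fun x => ∫ a, r x a ∂(π.act t x) := measurable_integral_kernel' hr
  have hm1 : Measurable fun x => ∫ a, ∫ y, ψ y ∂(transition σ (f x a)) ∂(π.act t x) :=
    measurable_integral_kernel' hm
  have hi1 := integrable_of_abs_le (μ := stateLaw σ f π s t) hr1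
    (fun x => abs_integral_le_of_abs_le (hr' x))
  have hi2 := integrable_of_abs_le (μ := stateLaw σ f π s t) hm1
    (fun x => abs_integral_le_of_abs_le fun a => hmb (x, a))
  rw [integral_stateLaw_succ hσ hf π s t hψ hb, ← integral_add hi1 hi2]
  refine integral_congr_ae (Filter.Eventually.of_forall fun x => ?_)
  exact (integral_add (integrable_of_abs_le (hrx x) (hr' x))
    (integrable_of_abs_le (hmx x) fun a => hmb (x, a))).symm

/-- The rewards expected before time t plus the expectation of V at s_t, with H − t steps to go, do
not depend on t. The index of `V` counts the steps to go. -/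
lemma value_eq_of_bellman (hσ : 0 < σ) (hf : Measurable (Function.uncurry f))
    (hr : Measurable (Function.uncurry r)) (hr01 : ∀ x a, r x a ∈ Set.Icc (0 : ℝ) 1)
    (π : Policy d A) (s : State d) {H : ℕ} {V : ℕ → State d → ℝ} {b : ℝ}
    (hV : ∀ n ≤ H, Measurable (V n)) (hb : ∀ n ≤ H, ∀ x, |V n x| ≤ b) (hV0 : ∀ x, V 0 x = 0)
    (hbell : ∀ t < H, ∀ x, ∀ᵐ a ∂(π.act t x),
      r x a + ∫ y, V (H - 1 - t) y ∂(transition σ (f x a)) = V (H - t) x) :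
    value σ r H f π s = V H s := by
  have := π.markov
  have key : ∀ t ≤ H, (∑ i ∈ Finset.range t, ∫ x, ∫ a, r x a ∂(π.act i x) ∂(stateLaw σ f π s i))
      + ∫ x, V (H - t) x ∂(stateLaw σ f π s t) = V H s := by
    intro t
    induction t with
    | zero =>
      intro _
      simp only [Finset.range_zero, Finset.sum_empty, zero_add, Nat.sub_zero, stateLaw]
      rw [integral_dirac' _ _ (hV H le_rfl).stronglyMeasurable]
    | succ t ih =>
      intro ht
      have hH : H - (t + 1) = H - 1 - t := by omega
      rw [← ih (by omega), Finset.sum_range_succ, add_assoc, hH,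
        reward_add_continuation hσ hf hr hr01 π s t (hV _ (by omega)) (hb _ (by omega))]
      congr 1
      refine integral_congr_ae (Filter.Eventually.of_forall fun x => ?_)
      dsimp only
      rw [integral_congr_ae (hbell t (by omega) x)]
      simp
  have := key H le_rfl
  simpa [hV0, value] using this

/-- The same quantity is non-increasing in t when V only dominates each one-step lookahead. -/
lemma value_le_of_bellman (hσ : 0 < σ) (hf : Measurable (Function.uncurry f))
    (hr : Measurable (Function.uncurry r)) (hr01 : ∀ x a, r x a ∈ Set.Icc (0 : ℝ) 1)
    (π : Policy d A) (s : State d) {H : ℕ} {V : ℕ → State d → ℝ} {b : ℝ}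
    (hV : ∀ n ≤ H, Measurable (V n)) (hb : ∀ n ≤ H, ∀ x, |V n x| ≤ b) (hV0 : ∀ x, V 0 x = 0)
    (hbell : ∀ t < H, ∀ x a,
      r x a + ∫ y, V (H - 1 - t) y ∂(transition σ (f x a)) ≤ V (H - t) x) :
    value σ r H f π s ≤ V H s := by
  have := π.markov
  have := isProbabilityMeasure_stateLaw hσ hf π s
  have := isMarkovKernel_transKer hσ _ hf
  have := isProbabilityMeasure_transition (d := d) hσ
  have hr' : ∀ x a, |r x a| ≤ 1 := fun x a => by
    rw [abs_of_nonneg (hr01 x a).1]; exact (hr01 x a).2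
  have key : ∀ t ≤ H, (∑ i ∈ Finset.range t, ∫ x, ∫ a, r x a ∂(π.act i x) ∂(stateLaw σ f π s i))
      + ∫ x, V (H - t) x ∂(stateLaw σ f π s t) ≤ V H s := by
    intro t
    induction t with
    | zero =>
      intro _
      simp only [Finset.range_zero, Finset.sum_empty, zero_add, Nat.sub_zero, stateLaw]
      rw [integral_dirac' _ _ (hV H le_rfl).stronglyMeasurable]
    | succ t ih =>
      intro ht
      have hH : H - (t + 1) = H - 1 - t := by omega
      refine le_trans ?_ (ih (by omega))
      rw [Finset.sum_range_succ, add_assoc, hH,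
        reward_add_continuation hσ hf hr hr01 π s t (hV _ (by omega)) (hb _ (by omega))]
      have hm : Measurable fun p : State d × A =>
          r p.1 p.2 + ∫ y, V (H - 1 - t) y ∂(transition σ (f p.1 p.2)) :=
        hr.add (measurable_integral_kernel (κ := transKer σ _ hf)
          (ψ := fun q => V (H - 1 - t) q.2) ((hV _ (by omega)).comp measurable_snd))
      have hmb : ∀ x a, |r x a + ∫ y, V (H - 1 - t) y ∂(transition σ (f x a))| ≤ 1 + b :=
        fun x a => (abs_add_le _ _).trans
          (add_le_add (hr' x a) (abs_integral_le_of_abs_le (hb _ (by omega))))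
      refine add_le_add le_rfl (integral_mono ?_ ?_ fun x => ?_)
      · exact integrable_of_abs_le (measurable_integral_kernel' hm)
          fun x => abs_integral_le_of_abs_le (hmb x)
      · exact integrable_of_abs_le (hV _ (by omega)) (hb _ (by omega))
      · have h1 := integral_mono (μ := π.act t x)
          (integrable_of_abs_le (measurable_section (ψ := fun x a =>
            r x a + ∫ y, V (H - 1 - t) y ∂(transition σ (f x a))) hm x) (hmb x))
          (integrable_const (V (H - t) x)) (fun a => hbell t (by omega) x a)
        simpa using h1
  have := key H le_rfl
  simpa [hV0, value] using this

end Values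

/-! ### Bounds on the planning value -/

section Planning

variable {d : ℕ} {A : Type*} {σ : ℝ} {r : State d → A → ℝ} {f : State d → A → State d}

/-- No measurability of `planV` enters: the bound on the absolute value of an integral also holds
for the default value 0. -/
lemma planV_mem_Icc [Nonempty A] (hσ : 0 < σ) (hr01 : ∀ x a, r x a ∈ Set.Icc (0 : ℝ) 1) (n : ℕ)
    (s : State d) : planV σ r f n s ∈ Set.Icc (0 : ℝ) n := by
  have := isProbabilityMeasure_transition (d := d) hσ
  induction n generalizing s with
  | zero => simp [planV]
  | succ n ih =>
    have habs : ∀ y, |planV σ r f n y| ≤ n := fun y => by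
      rw [abs_of_nonneg (ih y).1]; exact (ih y).2
    have hle : ∀ a, r s a + ∫ y, planV σ r f n y ∂(transition σ (f s a)) ≤ ((n + 1 : ℕ) : ℝ) := by
      intro a
      have h1 := (le_abs_self _).trans
        (abs_integral_le_of_abs_le (μ := transition σ (f s a)) habs)
      have h2 := (hr01 s a).2
      push_cast
      linarith
    rw [planV]
    refine ⟨?_, ciSup_le hle⟩
    exact Real.iSup_nonneg fun a => add_nonneg (hr01 s a).1 (integral_nonneg fun y => (ih y).1)

lemma abs_planV_le [Nonempty A] (hσ : 0 < σ) (hr01 : ∀ x a, r x a ∈ Set.Icc (0 : ℝ) 1) {n H : ℕ}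
    (hn : n ≤ H) (s : State d) : |planV σ r f n s| ≤ H := by
  have h := planV_mem_Icc (f := f) hσ hr01 n s
  rw [abs_of_nonneg h.1]
  exact h.2.trans (Nat.cast_le.2 hn)

/-- A real supremum dominates its terms only if they are bounded above; here 1 + n is a bound. -/
lemma le_planV_succ [Nonempty A] (hσ : 0 < σ) (hr01 : ∀ x a, r x a ∈ Set.Icc (0 : ℝ) 1) (n : ℕ)
    (s : State d) (a : A) :
    r s a + ∫ y, planV σ r f n y ∂(transition σ (f s a)) ≤ planV σ r f (n + 1) s := by
  have := isProbabilityMeasure_transition (d := d) hσ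
  rw [planV]
  refine le_ciSup (f := fun a => r s a + ∫ y, planV σ r f n y ∂(transition σ (f s a))) ?_ a
  refine ⟨1 + n, ?_⟩
  rintro _ ⟨b, rfl⟩
  exact add_le_add (hr01 s b).2 ((le_abs_self _).trans
    (abs_integral_le_of_abs_le fun y => abs_planV_le hσ hr01 le_rfl y))

end Planning

/-! ### Greedy planning attains the optimal value -/

section Planner

variable {d : ℕ} {A : Type*} [MeasurableSpace A] {σ : ℝ} {r : State d → A → ℝ}
  {F : Set (State d → A → State d)} [MeasurableSpace F] {H : ℕ}
  {plan : ℕ → Kernel (F × State d) A}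

lemma measurable_of_mem (hF : Measurable fun x : F × State d × A => x.1.1 x.2.1 x.2.2) (f : F) :
    Measurable (Function.uncurry f.1) :=
  hF.comp (measurable_prodMk_left (x := f))

lemma planQ_eq_planV [Nonempty A] (hσ : 0 < σ) (hr01 : ∀ x a, r x a ∈ Set.Icc (0 : ℝ) 1)
    (hplan : IsGreedyPlanner σ r H plan) (f : F) {h : ℕ} (hh : h < H) (s : State d) :
    ∀ᵐ a ∂(plan h (f, s)), planQ σ r H f.1 h s a = planV σ r f.1 (H - h) s := by
  filter_upwards [hplan f h hh s] with a ha
  have hH : H - h = (H - 1 - h) + 1 := by omega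
  refine le_antisymm ?_ ?_
  · rw [hH]
    exact le_planV_succ hσ hr01 _ s a
  · rw [hH, planV]
    exact ciSup_le ha

/-- The mean of the next state as a function of the model, the state and the action. -/
lemma measurable_mean (hF : Measurable fun x : F × State d × A => x.1.1 x.2.1 x.2.2) :
    Measurable fun p : (F × State d) × A => p.1.1.1 p.1.2 p.2 :=
  hF.comp ((measurable_fst.comp measurable_fst).prodMk
    ((measurable_snd.comp measurable_fst).prodMk measurable_snd))

/-- A supremum over an arbitrary action space need not be measurable. Since the planner attains it,
it equals the integral of `planQ` against the planner's kernel, which is measurable in model and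
state. -/
lemma measurable_planV [Nonempty A] [∀ h, IsMarkovKernel (plan h)] (hσ : 0 < σ)
    (hF : Measurable fun x : F × State d × A => x.1.1 x.2.1 x.2.2)
    (hr : Measurable (Function.uncurry r)) (hr01 : ∀ x a, r x a ∈ Set.Icc (0 : ℝ) 1)
    (hplan : IsGreedyPlanner σ r H plan) {n : ℕ} (hn : n ≤ H) :
    Measurable fun p : F × State d => planV σ r p.1.1 n p.2 := by
  have := isMarkovKernel_transKer hσ _ (measurable_mean hF)
  induction n with
  | zero => simp only [planV]; exact measurable_const
  | succ n ih =>
    -- With n + 1 steps to go the planner is at step H − 1 − n.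
    have hH : H - (H - 1 - n) = n + 1 := by omega
    have hH' : H - 1 - (H - 1 - n) = n := by omega
    have heq : (fun p : F × State d => planV σ r p.1.1 (n + 1) p.2) = fun p =>
        ∫ a, planQ σ r H p.1.1 (H - 1 - n) p.2 a ∂(plan (H - 1 - n) p) := by
      ext p
      have := integral_congr_ae (planQ_eq_planV hσ hr01 hplan p.1
        (h := H - 1 - n) (by omega) p.2)
      rw [this, hH]
      simp
    rw [heq]
    refine measurable_integral_kernel
      (ψ := fun q : (F × State d) × A => planQ σ r H q.1.1.1 (H - 1 - n) q.1.2 q.2) ?_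
    unfold planQ
    rw [hH']
    refine (hr.comp ((measurable_snd.comp measurable_fst).prodMk measurable_snd)).add ?_
    exact measurable_integral_kernel (κ := transKer σ _ (measurable_mean hF))
      (ψ := fun q : ((F × State d) × A) × State d => planV σ r q.1.1.1.1 n q.2)
      ((ih (by omega)).comp ((measurable_fst.comp (measurable_fst.comp measurable_fst)).prodMk
        measurable_snd))

lemma value_plannedPolicy [Nonempty A] [∀ h, IsMarkovKernel (plan h)] (hσ : 0 < σ)
    (hF : Measurable fun x : F × State d × A => x.1.1 x.2.1 x.2.2)
    (hr : Measurable (Function.uncurry r)) (hr01 : ∀ x a, r x a ∈ Set.Icc (0 : ℝ) 1)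
    (hplan : IsGreedyPlanner σ r H plan) (f : F) (s : State d) :
    value σ r H f.1 (plannedPolicy plan f) s = planV σ r f.1 H s :=
  value_eq_of_bellman hσ (measurable_of_mem hF f) hr hr01 _ s (V := planV σ r f.1)
    (fun _ hn => (measurable_planV hσ hF hr hr01 hplan hn).comp (measurable_prodMk_left (x := f)))
    (fun _ hn x => abs_planV_le hσ hr01 hn x) (fun _ => rfl)
    (fun _ ht x => planQ_eq_planV hσ hr01 hplan f ht x)

/-- Every policy satisfies the Bellman inequality for `planV`, and the planned policy attains
equality. -/
lemma optValue_eq_planV [Nonempty A] [∀ h, IsMarkovKernel (plan h)] (hσ : 0 < σ)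
    (hF : Measurable fun x : F × State d × A => x.1.1 x.2.1 x.2.2)
    (hr : Measurable (Function.uncurry r)) (hr01 : ∀ x a, r x a ∈ Set.Icc (0 : ℝ) 1)
    (hplan : IsGreedyPlanner σ r H plan) (f : F) (s : State d) :
    optValue σ r H f.1 s = planV σ r f.1 H s := by
  have hle : ∀ π : Policy d A, value σ r H f.1 π s ≤ planV σ r f.1 H s := fun π =>
    value_le_of_bellman hσ (measurable_of_mem hF f) hr hr01 _ s (V := planV σ r f.1)
      (fun _ hn => (measurable_planV hσ hF hr hr01 hplan hn).comp (measurable_prodMk_left (x := f)))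
      (fun _ hn x => abs_planV_le hσ hr01 hn x) (fun _ => rfl)
      (fun t ht x a => by
        have hH : H - t = (H - 1 - t) + 1 := by omega
        rw [hH]
        exact le_planV_succ hσ hr01 _ x a)
  have : Nonempty (Policy d A) := ⟨plannedPolicy plan f⟩
  refine le_antisymm (ciSup_le hle) ?_
  rw [← value_plannedPolicy hσ hF hr hr01 hplan f s]
  exact le_ciSup (f := fun π => value σ r H f.1 π s)
    ⟨planV σ r f.1 H s, by rintro _ ⟨π, rfl⟩; exact hle π⟩ _

end Planner

/-! ### Conditional laws as joint laws -/

section CondLaw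

variable {Ω B Y Z : Type*} [MeasurableSpace B] [MeasurableSpace Y] [MeasurableSpace Z]

/-- For any m-measurable y that determines the kernel, the conditional law becomes a product of a
marginal and a kernel; it is enough to compare rectangles. Expectations are then computed by Fubini.
-/
lemma IsCondLaw.map_prodMk {m : MeasurableSpace Ω} [mΩ : MeasurableSpace Ω] {μ : Measure Ω}
    [IsProbabilityMeasure μ] {X : Ω → B} {y : Ω → Y} {K : Kernel Y B} [IsMarkovKernel K]
    (h : IsCondLaw m μ X fun ω => K (y ω)) (hm : m ≤ mΩ) (hy : Measurable[m] y)
    (hX : Measurable X) :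
    μ.map (fun ω => (y ω, X ω)) = μ.map y ⊗ₘ K := by
  have hy' : Measurable y := hy.mono hm le_rfl
  have := Measure.isProbabilityMeasure_map (μ := μ) hy'.aemeasurable
  have := Measure.isProbabilityMeasure_map (μ := μ) (hy'.prodMk hX).aemeasurable
  refine Measure.ext_prod fun {G E} hG hE => ?_
  rw [Measure.compProd_apply_prod hG hE, Measure.map_apply (hy'.prodMk hX) (hG.prod hE),
    setLIntegral_map hG (K.measurable_coe hE) hy', ← h _ (hy hG) E hE]
  rfl

lemma integral_of_map_prodMk [MeasurableSpace Ω] {μ : Measure Ω} [IsProbabilityMeasure μ]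
    {X : Ω → B} {y : Ω → Y} {K : Kernel Y B} [IsMarkovKernel K] (hy : Measurable y)
    (hX : Measurable X) (h : μ.map (fun ω => (y ω, X ω)) = μ.map y ⊗ₘ K) {ψ : Y × B → ℝ}
    (hψ : Measurable ψ) {b : ℝ} (hb : ∀ p, |ψ p| ≤ b) :
    ∫ ω, ψ (y ω, X ω) ∂μ = ∫ ω, ∫ x, ψ (y ω, x) ∂(K (y ω)) ∂μ := by
  have := Measure.isProbabilityMeasure_map (μ := μ) hy.aemeasurable
  rw [← integral_map (φ := fun ω => (y ω, X ω)) (f := ψ) (hy.prodMk hX).aemeasurable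
    hψ.aestronglyMeasurable, h, Measure.integral_compProd (integrable_of_abs_le hψ hb),
    integral_map hy.aemeasurable (measurable_integral_kernel hψ).aestronglyMeasurable]

lemma lintegral_of_map_prodMk [MeasurableSpace Ω] {μ : Measure Ω} [IsProbabilityMeasure μ]
    {X : Ω → B} {y : Ω → Y} {K : Kernel Y B} [IsMarkovKernel K] (hy : Measurable y)
    (hX : Measurable X) (h : μ.map (fun ω => (y ω, X ω)) = μ.map y ⊗ₘ K) {ψ : Y × B → ℝ≥0∞}
    (hψ : Measurable ψ) :
    ∫⁻ ω, ψ (y ω, X ω) ∂μ = ∫⁻ ω, ∫⁻ x, ψ (y ω, x) ∂(K (y ω)) ∂μ := by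
  have := Measure.isProbabilityMeasure_map (μ := μ) hy.aemeasurable
  rw [← lintegral_map (f := ψ) (g := fun ω => (y ω, X ω)) hψ (hy.prodMk hX), h,
    Measure.lintegral_compProd hψ, lintegral_map (hψ.lintegral_kernel_prod_right') hy]

/-- Chapman–Kolmogorov: the intermediate variable `X` is integrated out. -/
lemma map_prodMk_trans [MeasurableSpace Ω] {μ : Measure Ω} [IsProbabilityMeasure μ]
    {X : Ω → B} {y : Ω → Y} {W : Ω → Z} {K : Kernel Y B} [IsMarkovKernel K]
    {L : Kernel (Y × B) Z} [IsMarkovKernel L] (hy : Measurable y)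
    (hX : Measurable X) (hW : Measurable W)
    (h : μ.map (fun ω => (y ω, X ω)) = μ.map y ⊗ₘ K)
    (h' : μ.map (fun ω => ((y ω, X ω), W ω)) = μ.map (fun ω => (y ω, X ω)) ⊗ₘ L) :
    μ.map (fun ω => (y ω, W ω)) = μ.map y ⊗ₘ (K ⊗ₖ L).snd := by
  have := Measure.isProbabilityMeasure_map (μ := μ) hy.aemeasurable
  have := Measure.isProbabilityMeasure_map (μ := μ) (hy.prodMk hX).aemeasurable
  have := Measure.isProbabilityMeasure_map (μ := μ) (hy.prodMk hW).aemeasurable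
  refine Measure.ext_prod fun {G E} hG hE => ?_
  have e1 : μ.map (fun ω => (y ω, W ω)) (G ×ˢ E) =
      μ.map (fun ω => ((y ω, X ω), W ω)) ((G ×ˢ Set.univ) ×ˢ E) := by
    rw [Measure.map_apply (hy.prodMk hW) (hG.prod hE),
      Measure.map_apply ((hy.prodMk hX).prodMk hW) ((hG.prod .univ).prod hE)]
    congr 1
    ext ω
    simp
  rw [e1, h', Measure.compProd_apply_prod (hG.prod .univ) hE, h,
    Measure.setLIntegral_compProd (L.measurable_coe hE) hG .univ,
    Measure.compProd_apply_prod hG hE]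
  refine lintegral_congr fun x => ?_
  rw [Measure.restrict_univ, Kernel.snd_apply' _ _ hE, Kernel.compProd_apply (measurable_snd hE)]
  rfl

end CondLaw

/-! ### Measurability with respect to the information of a run -/

section Info

variable {d : ℕ} {A : Type*} [MeasurableSpace A] {F : Set (State d → A → State d)}
  [MeasurableSpace F] {H : ℕ} {Ω : Type*} {fstar : Ω → F} {fs : ℕ → Ω → F}
  {s : ℕ → ℕ → Ω → State d} {a : ℕ → ℕ → Ω → A}

lemma measurable_historyInfo {k j h : ℕ} (hj : j < k) (hh : h < H) :
    Measurable[historyInfo H s a k] fun ω => (s j h ω, a j h ω, s j (h + 1) ω) :=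
  measurable_iff_comap_le.2 (le_iSup₂_of_le j hj (le_iSup₂_of_le h hh le_rfl))

lemma historyInfo_le_stepInfo (k h : ℕ) :
    historyInfo H s a k ≤ stepInfo H fstar fs s a k h :=
  le_sup_of_le_left (le_sup_of_le_left (le_sup_of_le_left le_sup_right))

lemma measurable_fstar_pastInfo (k : ℕ) : Measurable[pastInfo H fstar fs s a k] fstar :=
  measurable_iff_comap_le.2 (le_sup_of_le_left le_sup_left)

lemma measurable_fstar_stepInfo (k h : ℕ) : Measurable[stepInfo H fstar fs s a k h] fstar :=
  (measurable_fstar_pastInfo (H := H) (fs := fs) (s := s) (a := a) k).mono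
    (le_sup_of_le_left (le_sup_of_le_left le_sup_left)) le_rfl

lemma measurable_fs_stepInfo (k h : ℕ) : Measurable[stepInfo H fstar fs s a k h] (fs k) :=
  measurable_iff_comap_le.2 (le_sup_of_le_left (le_sup_of_le_left le_sup_right))

lemma measurable_s_stepInfo {k h i : ℕ} (hi : i ≤ h) :
    Measurable[stepInfo H fstar fs s a k h] (s k i) :=
  measurable_iff_comap_le.2 (le_sup_of_le_left (le_sup_of_le_right (le_iSup₂_of_le i hi le_rfl)))

lemma measurable_a_stepInfo {k h i : ℕ} (hi : i < h) :
    Measurable[stepInfo H fstar fs s a k h] (a k i) :=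
  measurable_iff_comap_le.2 (le_sup_of_le_right (le_iSup₂_of_le i hi le_rfl))

lemma measurable_a_actInfo (k h : ℕ) :
    Measurable[stepInfo H fstar fs s a k h ⊔ MeasurableSpace.comap (a k h) inferInstance]
      (a k h) := measurable_iff_comap_le.2 le_sup_right

end Info

/-! ### Joint laws along a Thompson-sampling run -/

section Run

variable {d : ℕ} {A : Type*} [MeasurableSpace A] {σ : ℝ} {r : State d → A → ℝ}
  {F : Set (State d → A → State d)} [MeasurableSpace F] {H : ℕ}
  {plan : ℕ → Kernel (F × State d) A} {Ω : Type*} [mΩ : MeasurableSpace Ω]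
  {μ : Measure Ω} {fstar : Ω → F} {post : ℕ → Ω → Measure F}
  {fs : ℕ → Ω → F} {s : ℕ → ℕ → Ω → State d} {a : ℕ → ℕ → Ω → A} {ρ : Measure (State d)}
  {P : Measure F}

lemma IsThompsonRun.historyInfo_le (hrun : IsThompsonRun σ H ρ P plan μ fstar post fs s a) (k : ℕ) :
    historyInfo H s a k ≤ mΩ := by
  refine iSup₂_le fun j _ => iSup₂_le fun h _ => ?_
  rw [← measurable_iff_comap_le]
  exact (hrun.measurable_s j h).prodMk ((hrun.measurable_a j h).prodMk (hrun.measurable_s j (h + 1)))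

lemma IsThompsonRun.pastInfo_le (hrun : IsThompsonRun σ H ρ P plan μ fstar post fs s a) (k : ℕ) :
    pastInfo H fstar fs s a k ≤ mΩ :=
  sup_le (sup_le (measurable_iff_comap_le.1 hrun.measurable_fstar)
    (iSup₂_le fun j _ => measurable_iff_comap_le.1 (hrun.measurable_fs j))) (hrun.historyInfo_le k)

lemma IsThompsonRun.initInfo_le (hrun : IsThompsonRun σ H ρ P plan μ fstar post fs s a) (k : ℕ) :
    pastInfo H fstar fs s a k ⊔ MeasurableSpace.comap (fs k) inferInstance ≤ mΩ :=
  sup_le (hrun.pastInfo_le k) (measurable_iff_comap_le.1 (hrun.measurable_fs k))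

lemma IsThompsonRun.stepInfo_le (hrun : IsThompsonRun σ H ρ P plan μ fstar post fs s a)
    (k h : ℕ) : stepInfo H fstar fs s a k h ≤ mΩ :=
  sup_le (sup_le (hrun.initInfo_le k)
    (iSup₂_le fun i _ => measurable_iff_comap_le.1 (hrun.measurable_s k i)))
    (iSup₂_le fun i _ => measurable_iff_comap_le.1 (hrun.measurable_a k i))

lemma IsThompsonRun.actInfo_le (hrun : IsThompsonRun σ H ρ P plan μ fstar post fs s a)
    (k h : ℕ) :
    stepInfo H fstar fs s a k h ⊔ MeasurableSpace.comap (a k h) inferInstance ≤ mΩ :=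
  sup_le (hrun.stepInfo_le k h) (measurable_iff_comap_le.1 (hrun.measurable_a k h))

variable [IsProbabilityMeasure μ]

/-- Posterior sampling: given the history, the sampled model is distributed as the true model. -/
lemma IsThompsonRun.map_sample_eq (hrun : IsThompsonRun σ H ρ P plan μ fstar post fs s a) (k : ℕ)
    {D : Type*} [MeasurableSpace D] {δ : Ω → D} (hδ : Measurable[historyInfo H s a k] δ) :
    μ.map (fun ω => (δ ω, fs k ω)) = μ.map (fun ω => (δ ω, fstar ω)) := by
  have hδ' : Measurable δ := hδ.mono (hrun.historyInfo_le k) le_rfl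
  have := Measure.isProbabilityMeasure_map (μ := μ) (hδ'.prodMk (hrun.measurable_fs k)).aemeasurable
  refine Measure.ext_prod fun {G E} hG hE => ?_
  rw [Measure.map_apply (hδ'.prodMk (hrun.measurable_fs k)) (hG.prod hE),
    Measure.map_apply (hδ'.prodMk hrun.measurable_fstar) (hG.prod hE)]
  -- Both probabilities are the integral of the same posterior over an event of the history. The
  -- sampling rule conditions on more, in particular on such events.
  have h1 := (hrun.posterior k).condLaw _ (hδ hG) E hE
  have hle : historyInfo H s a k ≤ pastInfo H fstar fs s a k := le_sup_right
  have h2 := hrun.sample k _ (hle _ (hδ hG)) E hE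
  exact h2.trans h1.symm

/-- The initial state is independent of each of the two models, so equality of their marginal laws
suffices. -/
lemma IsThompsonRun.map_init_eq [IsProbabilityMeasure ρ]
    (hrun : IsThompsonRun σ H ρ P plan μ fstar post fs s a) (k : ℕ) :
    μ.map (fun ω => (fs k ω, s k 0 ω)) = μ.map (fun ω => (fstar ω, s k 0 ω)) := by
  have h0 := hrun.init k
  have h1 := IsCondLaw.map_prodMk (y := fs k) (K := Kernel.const F ρ) h0 (hrun.initInfo_le k)
    (measurable_iff_comap_le.2 le_sup_right) (hrun.measurable_s k 0)
  have h2 := IsCondLaw.map_prodMk (y := fstar) (K := Kernel.const F ρ) h0 (hrun.initInfo_le k)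
    ((measurable_fstar_pastInfo k).mono le_sup_left le_rfl) (hrun.measurable_s k 0)
  -- Constant information reduces posterior sampling to equality of the marginals.
  have h3 := hrun.map_sample_eq k (δ := fun _ => ()) measurable_const
  have h4 : μ.map (fs k) = μ.map fstar := by
    have := congrArg (Measure.map Prod.snd) h3
    rwa [Measure.map_map measurable_snd (measurable_const.prodMk (hrun.measurable_fs k)),
      Measure.map_map measurable_snd (measurable_const.prodMk hrun.measurable_fstar)] at this
  rw [h1, h2, h4]

lemma IsThompsonRun.map_action (hrun : IsThompsonRun σ H ρ P plan μ fstar post fs s a)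
    [∀ h, IsMarkovKernel (plan h)] {k h : ℕ} (hh : h < H) {Y : Type*} [MeasurableSpace Y]
    {y : Ω → Y} (hy : Measurable[stepInfo H fstar fs s a k h] y) {q : Y → F × State d}
    (hq : Measurable q) (hqy : ∀ ω, q (y ω) = (fs k ω, s k h ω)) :
    μ.map (fun ω => (y ω, a k h ω)) = μ.map y ⊗ₘ (plan h).comap q hq := by
  have h0 := hrun.action k h hh
  refine IsCondLaw.map_prodMk (m := stepInfo H fstar fs s a k h) ?_ (hrun.stepInfo_le k h) hy
    (hrun.measurable_a k h)
  simpa only [Kernel.comap_apply, hqy] using h0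

lemma IsThompsonRun.map_step (hσ : 0 < σ) (hrun : IsThompsonRun σ H ρ P plan μ fstar post fs s a)
    {k h : ℕ} (hh : h < H) {Y : Type*} [MeasurableSpace Y]
    {y : Ω → Y} (hy : Measurable[stepInfo H fstar fs s a k h ⊔
      MeasurableSpace.comap (a k h) inferInstance] y) {φ : Y → State d}
    (hφ : Measurable φ) (hφy : ∀ ω, φ (y ω) = (fstar ω).1 (s k h ω) (a k h ω)) :
    μ.map (fun ω => (y ω, s k (h + 1) ω)) = μ.map y ⊗ₘ transKer σ φ hφ := by
  have h0 := hrun.step k h hh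
  have := isMarkovKernel_transKer hσ φ hφ
  refine IsCondLaw.map_prodMk (m := stepInfo H fstar fs s a k h ⊔
      MeasurableSpace.comap (a k h) inferInstance) ?_ (hrun.actInfo_le k h) hy
    (hrun.measurable_s k (h + 1))
  simpa only [transKer_apply, hφy] using h0

/-- The state in step `t` of episode `k` follows the law that enters the value of the planned
policy under the true model. -/
lemma IsThompsonRun.map_state (hσ : 0 < σ)
    (hrun : IsThompsonRun σ H ρ P plan μ fstar post fs s a) [∀ h, IsMarkovKernel (plan h)]
    (k : ℕ) (φ : ((F × F × State d) × State d) × A → State d) (hφ : Measurable φ)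
    (hφF : ∀ p, φ p = p.1.1.1.1 p.1.2 p.2)
    {q : (F × F × State d) × State d → F × State d} (hq : Measurable q)
    (hqF : ∀ p, q p = (p.1.2.1, p.2)) {s₀ : F × F × State d → State d} (hs₀ : Measurable s₀)
    (hs₀F : ∀ p, s₀ p = p.2.2) {t : ℕ} (ht : t ≤ H) :
    μ.map (fun ω => ((fstar ω, fs k ω, s k 0 ω), s k t ω)) =
      μ.map (fun ω => (fstar ω, fs k ω, s k 0 ω)) ⊗ₘ
        lawKer σ φ hφ (fun t => (plan t).comap q hq) s₀ hs₀ t := by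
  have hζ : Measurable fun ω => (fstar ω, fs k ω, s k 0 ω) :=
    hrun.measurable_fstar.prodMk ((hrun.measurable_fs k).prodMk (hrun.measurable_s k 0))
  have := isMarkovKernel_transKer hσ φ hφ
  have := fun t => isMarkovKernel_lawKer hσ φ hφ (fun t => (plan t).comap q hq) s₀ hs₀ t
  induction t with
  | zero =>
    rw [lawKer, Measure.compProd_deterministic, Measure.map_map
      (measurable_id'.prodMk hs₀) hζ]
    congr 1
    ext1 ω
    simp [hs₀F]
  | succ t ih =>
    rw [lawKer]
    have hζt : Measurable[stepInfo H fstar fs s a k t] fun ω =>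
        ((fstar ω, fs k ω, s k 0 ω), s k t ω) :=
      ((measurable_fstar_stepInfo k t).prodMk ((measurable_fs_stepInfo k t).prodMk
        (measurable_s_stepInfo (Nat.zero_le t)))).prodMk (measurable_s_stepInfo le_rfl)
    refine map_prodMk_trans hζ (hrun.measurable_s k t) (hrun.measurable_s k (t + 1))
      (ih (by omega)) ?_
    -- The action is integrated out first, inside the transition from s_t to s_{t+1}.
    refine map_prodMk_trans (hζ.prodMk (hrun.measurable_s k t)) (hrun.measurable_a k t)
      (hrun.measurable_s k (t + 1)) (hrun.map_action (by omega) hζt hq fun ω => by rw [hqF]) ?_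
    refine hrun.map_step hσ (by omega) ?_ hφ fun ω => by rw [hφF]
    exact (hζt.mono le_sup_left le_rfl).prodMk (measurable_a_actInfo k t)

end Run

/-! ### Pointwise bounds on model errors -/

section Norm

lemma measurable_integral_transition {d : ℕ} {Ω W : Type*} [MeasurableSpace Ω] [MeasurableSpace W]
    {σ : ℝ} (hσ : 0 < σ) {m : Ω → State d} (hm : Measurable m)
    {V : W → State d → ℝ} (hV : Measurable fun p : W × State d => V p.1 p.2) {g : Ω → W}
    (hg : Measurable g) : Measurable fun ω => ∫ y, V (g ω) y ∂(transition σ (m ω)) := by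
  have := isMarkovKernel_transKer hσ m hm
  exact measurable_integral_kernel' (κ := transKer σ m hm) (ψ := fun ω y => V (g ω) y)
    (hV.comp ((hg.comp measurable_fst).prodMk measurable_snd))

variable {d : ℕ} {A : Type*}

/-- The maximum with 0 accounts for `ENNReal.ofReal`, which sends negative C to 0. -/
lemma norm_le_of_fnNorm_le {f : State d → A → State d} {C : ℝ}
    (h : fnNorm f ≤ ENNReal.ofReal C) (s : State d) (a : A) : ‖f s a‖ ≤ max C 0 := by
  have h1 : ‖f s a‖ₑ ≤ ENNReal.ofReal C :=
    (le_iSup_of_le s (le_iSup (fun a => ‖f s a‖ₑ) a)).trans h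
  rw [← ofReal_norm] at h1
  rcases le_total 0 C with h0 | h0
  · exact ((ENNReal.ofReal_le_ofReal_iff h0).1 h1).trans (le_max_left _ _)
  · rw [ENNReal.ofReal_of_nonpos h0, nonpos_iff_eq_zero, ENNReal.ofReal_eq_zero] at h1
    exact h1.trans (le_max_right _ _)

variable {F : Set (State d → A → State d)} {Ω : Type*} {fstar : Ω → F} {fs : ℕ → Ω → F}
  {s : ℕ → ℕ → Ω → State d} {a : ℕ → ℕ → Ω → A}

/-- The error of the model sampled in episode `k` at the state-action pair of step `h` of
episode `j`. -/
noncomputable def modelError (fstar : Ω → F) (fs : ℕ → Ω → F) (s : ℕ → ℕ → Ω → State d)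
    (a : ℕ → ℕ → Ω → A) (k j h : ℕ) (ω : Ω) : ℝ :=
  ‖(fs k ω).1 (s j h ω) (a j h ω) - (fstar ω).1 (s j h ω) (a j h ω)‖

lemma modelError_le {C : ℝ} (hC : ∀ f ∈ F, fnNorm f ≤ ENNReal.ofReal C) (k j h : ℕ) (ω : Ω) :
    modelError fstar fs s a k j h ω ≤ 2 * max C 0 := by
  refine (norm_sub_le _ _).trans ?_
  have h1 := norm_le_of_fnNorm_le (hC _ (fs k ω).2) (s j h ω) (a j h ω)
  have h2 := norm_le_of_fnNorm_le (hC _ (fstar ω).2) (s j h ω) (a j h ω)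
  linarith

lemma abs_modelError_le {C : ℝ} (hC : ∀ f ∈ F, fnNorm f ≤ ENNReal.ofReal C) (k j h : ℕ) (ω : Ω) :
    |modelError fstar fs s a k j h ω| ≤ 2 * max C 0 :=
  (abs_of_nonneg (norm_nonneg _)).trans_le (modelError_le hC k j h ω)

end Norm

/-! ### From regret to expected model errors -/

section Regret

variable {d : ℕ} {A : Type*} [MeasurableSpace A] {σ : ℝ} {r : State d → A → ℝ}
  {F : Set (State d → A → State d)} [MeasurableSpace F] {H : ℕ}
  {plan : ℕ → Kernel (F × State d) A} {Ω : Type*} [mΩ : MeasurableSpace Ω]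
  {μ : Measure Ω} {fstar : Ω → F} {post : ℕ → Ω → Measure F}
  {fs : ℕ → Ω → F} {s : ℕ → ℕ → Ω → State d} {a : ℕ → ℕ → Ω → A} {ρ : Measure (State d)}
  {P : Measure F}

lemma IsThompsonRun.measurable_modelError
    (hF : Measurable fun x : F × State d × A => x.1.1 x.2.1 x.2.2)
    (hrun : IsThompsonRun σ H ρ P plan μ fstar post fs s a) (k j h : ℕ) :
    Measurable (modelError fstar fs s a k j h) := by
  have h1 : Measurable fun ω => (fs k ω).1 (s j h ω) (a j h ω) := hF.comp
    ((hrun.measurable_fs k).prodMk ((hrun.measurable_s j h).prodMk (hrun.measurable_a j h)))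
  have h2 : Measurable fun ω => (fstar ω).1 (s j h ω) (a j h ω) := hF.comp
    (hrun.measurable_fstar.prodMk ((hrun.measurable_s j h).prodMk (hrun.measurable_a j h)))
  exact (h1.sub h2).norm

variable [∀ h, IsMarkovKernel (plan h)]

lemma measurable_value_plannedPolicy (hσ : 0 < σ)
    (hF : Measurable fun x : F × State d × A => x.1.1 x.2.1 x.2.2)
    (hr : Measurable (Function.uncurry r)) :
    Measurable fun z : F × F × State d =>
      value σ r H z.1.1 (plannedPolicy plan z.2.1) z.2.2 := by
  have hφ : Measurable fun p : ((F × F × State d) × State d) × A => p.1.1.1.1 p.1.2 p.2 :=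
    hF.comp ((measurable_fst.comp (measurable_fst.comp measurable_fst)).prodMk
      ((measurable_snd.comp measurable_fst).prodMk measurable_snd))
  have hq : Measurable fun p : (F × F × State d) × State d => (p.1.2.1, p.2) :=
    (measurable_fst.comp (measurable_snd.comp measurable_fst)).prodMk measurable_snd
  exact measurable_value hσ _ hφ (fun t => (plan t).comap _ hq) (fun z => z.2.2)
    (measurable_snd.comp measurable_snd) (f := fun z => z.1.1) (fun _ _ _ => rfl)
    (π := fun z => plannedPolicy plan z.2.1) (fun _ _ _ => rfl) hr H

/-- The optimal value is a supremum over all policies; measurability comes from its identification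
with `planV`. -/
lemma IsThompsonRun.measurable_regret_term [Nonempty A] (hσ : 0 < σ)
    (hF : Measurable fun x : F × State d × A => x.1.1 x.2.1 x.2.2)
    (hr : Measurable (Function.uncurry r)) (hr01 : ∀ x a, r x a ∈ Set.Icc (0 : ℝ) 1)
    (hplan : IsGreedyPlanner σ r H plan)
    (hrun : IsThompsonRun σ H ρ P plan μ fstar post fs s a) (k : ℕ) :
    Measurable fun ω => optValue σ r H (fstar ω).1 (s k 0 ω) -
      value σ r H (fstar ω).1 (plannedPolicy plan (fs k ω)) (s k 0 ω) := by
  simp_rw [optValue_eq_planV hσ hF hr hr01 hplan]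
  refine Measurable.sub ?_ ?_
  · exact (measurable_planV hσ hF hr hr01 hplan le_rfl).comp
      (hrun.measurable_fstar.prodMk (hrun.measurable_s k 0))
  · exact (measurable_value_plannedPolicy hσ hF hr).comp
      (hrun.measurable_fstar.prodMk ((hrun.measurable_fs k).prodMk (hrun.measurable_s k 0)))

variable [IsProbabilityMeasure μ]

/-- The value is a conditional expectation of the rewards of the run given f*, f_k and the initial
state, so its mean is the mean of the rewards actually collected. -/
lemma IsThompsonRun.integral_value (hσ : 0 < σ)
    (hF : Measurable fun x : F × State d × A => x.1.1 x.2.1 x.2.2)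
    (hr : Measurable (Function.uncurry r)) (hr01 : ∀ x a, r x a ∈ Set.Icc (0 : ℝ) 1)
    (hrun : IsThompsonRun σ H ρ P plan μ fstar post fs s a) (k : ℕ) :
    ∫ ω, value σ r H (fstar ω).1 (plannedPolicy plan (fs k ω)) (s k 0 ω) ∂μ =
      ∑ t ∈ Finset.range H, ∫ ω, r (s k t ω) (a k t ω) ∂μ := by
  have hr' : ∀ x a, |r x a| ≤ 1 := fun x a => by
    rw [abs_of_nonneg (hr01 x a).1]; exact (hr01 x a).2
  have hφ : Measurable fun p : ((F × F × State d) × State d) × A => p.1.1.1.1 p.1.2 p.2 :=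
    hF.comp ((measurable_fst.comp (measurable_fst.comp measurable_fst)).prodMk
      ((measurable_snd.comp measurable_fst).prodMk measurable_snd))
  have hq : Measurable fun p : (F × F × State d) × State d => (p.1.2.1, p.2) :=
    (measurable_fst.comp (measurable_snd.comp measurable_fst)).prodMk measurable_snd
  have hs₀ : Measurable fun p : F × F × State d => p.2.2 := measurable_snd.comp measurable_snd
  have hζ : Measurable fun ω => (fstar ω, fs k ω, s k 0 ω) :=
    hrun.measurable_fstar.prodMk ((hrun.measurable_fs k).prodMk (hrun.measurable_s k 0))
  set Λ := lawKer σ _ hφ (fun t => (plan t).comap _ hq) _ hs₀ with hΛ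
  have := fun t => isMarkovKernel_lawKer hσ _ hφ (fun t => (plan t).comap _ hq) _ hs₀ t
  have hlaw : ∀ ω t, stateLaw σ (fstar ω).1 (plannedPolicy plan (fs k ω)) (s k 0 ω) t =
      Λ t (fstar ω, fs k ω, s k 0 ω) := fun ω t =>
    (lawKer_apply hσ _ hφ (fun t => (plan t).comap _ hq) _ hs₀ (fstar ω, fs k ω, s k 0 ω)
      (f := (fstar ω).1) (fun _ _ => rfl) (π := plannedPolicy plan (fs k ω))
      (fun _ _ => rfl) t).symm
  have hψ : ∀ t, Measurable fun p : (F × F × State d) × State d =>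
      ∫ x, r p.2 x ∂((plan t).comap _ hq p) := fun t =>
    measurable_integral_kernel' (ψ := fun p : (F × F × State d) × State d => r p.2)
      (hr.comp ((measurable_snd.comp measurable_fst).prodMk measurable_snd))
  unfold value
  simp_rw [hlaw]
  rw [integral_finsetSum]
  · refine Finset.sum_congr rfl fun t ht => ?_
    rw [Finset.mem_range] at ht
    have h1 := integral_of_map_prodMk (K := Λ t) hζ (hrun.measurable_s k t)
      (hrun.map_state hσ k _ hφ (fun _ => rfl) hq (fun _ => rfl) hs₀ (fun _ => rfl) ht.le) (hψ t)
      (b := 1) fun p => abs_integral_le_of_abs_le (hr' _)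
    have hζt : Measurable[stepInfo H fstar fs s a k t] fun ω =>
        ((fstar ω, fs k ω, s k 0 ω), s k t ω) :=
      ((measurable_fstar_stepInfo k t).prodMk ((measurable_fs_stepInfo k t).prodMk
        (measurable_s_stepInfo (Nat.zero_le t)))).prodMk (measurable_s_stepInfo le_rfl)
    have h2 := integral_of_map_prodMk (hζ.prodMk (hrun.measurable_s k t)) (hrun.measurable_a k t)
      (hrun.map_action ht hζt hq fun _ => rfl)
      (ψ := fun p : ((F × F × State d) × State d) × A => r p.1.2 p.2)
      (hr.comp ((measurable_snd.comp measurable_fst).prodMk measurable_snd)) fun p => hr' _ _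
    exact (h2.trans h1).symm
  · intro t _
    refine integrable_of_abs_le (b := 1) ?_ fun ω => ?_
    · exact (measurable_integral_kernel (κ := Λ t) (hψ t)).comp hζ
    · have := (plannedPolicy plan (fs k ω)).markov
      exact abs_integral_le_of_abs_le fun x => abs_integral_le_of_abs_le (hr' x)

/-- The expected planning value drops in one step by the reward, up to the effect of the model
error on the transition. -/
lemma IsThompsonRun.integral_planV_sub_le [Nonempty A] (hσ : 0 < σ)
    (hF : Measurable fun x : F × State d × A => x.1.1 x.2.1 x.2.2)
    (hr : Measurable (Function.uncurry r)) (hr01 : ∀ x a, r x a ∈ Set.Icc (0 : ℝ) 1)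
    (hplan : IsGreedyPlanner σ r H plan) {C : ℝ} (hC : ∀ f ∈ F, fnNorm f ≤ ENNReal.ofReal C)
    (hrun : IsThompsonRun σ H ρ P plan μ fstar post fs s a) (k : ℕ) {h : ℕ} (hh : h < H) :
    ∫ ω, planV σ r (fs k ω).1 (H - h) (s k h ω) ∂μ -
        ∫ ω, planV σ r (fs k ω).1 (H - 1 - h) (s k (h + 1) ω) ∂μ
      ≤ ∫ ω, r (s k h ω) (a k h ω) ∂μ +
        H * ((Real.exp ((2 * max C 0) ^ 2 / σ ^ 2) + 1) / (2 * σ)) *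
          ∫ ω, modelError fstar fs s a k k h ω ∂μ := by
  have hr' : ∀ x a, |r x a| ≤ 1 := fun x a => by
    rw [abs_of_nonneg (hr01 x a).1]; exact (hr01 x a).2
  have hprob := isProbabilityMeasure_transition (d := d) hσ
  have hV := measurable_planV hσ hF hr hr01 hplan (n := H - 1 - h) (by omega)
  have hVb : ∀ (f : F) x, |planV σ r f.1 (H - 1 - h) x| ≤ H := fun f x =>
    abs_planV_le hσ hr01 (by omega) x
  have hk := isMarkovKernel_transKer hσ _ (measurable_mean hF)
  have hcont : Measurable fun p : (F × State d) × A =>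
      ∫ y, planV σ r p.1.1.1 (H - 1 - h) y ∂(transition σ (p.1.1.1 p.1.2 p.2)) :=
    measurable_integral_kernel' (κ := transKer σ _ (measurable_mean hF))
      (ψ := fun (p : (F × State d) × A) y => planV σ r p.1.1.1 (H - 1 - h) y)
      (hV.comp ((measurable_fst.comp (measurable_fst.comp measurable_fst)).prodMk
        measurable_snd))
  have hQ : Measurable fun p : (F × State d) × A => planQ σ r H p.1.1.1 h p.1.2 p.2 :=
    Measurable.add (hr.comp ((measurable_snd.comp measurable_fst).prodMk measurable_snd)) hcont
  have hQb : ∀ p : (F × State d) × A, |planQ σ r H p.1.1.1 h p.1.2 p.2| ≤ 1 + H := fun p =>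
    (abs_add_le _ _).trans (add_le_add (hr' _ _) (abs_integral_le_of_abs_le (hVb _)))
  have hmfs := hrun.measurable_fs k
  have hmst := hrun.measurable_fstar
  have hms := hrun.measurable_s k h
  have hma := hrun.measurable_a k h
  -- the value before the step
  have e1 : ∫ ω, planV σ r (fs k ω).1 (H - h) (s k h ω) ∂μ =
      ∫ ω, planQ σ r H (fs k ω).1 h (s k h ω) (a k h ω) ∂μ := by
    have h1 := integral_of_map_prodMk (hmfs.prodMk hms) hma
      (hrun.map_action hh (y := fun ω => (fs k ω, s k h ω))
        ((measurable_fs_stepInfo k h).prodMk (measurable_s_stepInfo le_rfl)) measurable_id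
        fun _ => rfl) hQ hQb
    refine Eq.trans ?_ h1.symm
    refine integral_congr_ae (Filter.Eventually.of_forall fun ω => ?_)
    have h2 := integral_congr_ae (planQ_eq_planV hσ hr01 hplan (fs k ω) hh (s k h ω))
    simp only [integral_const, probReal_univ, smul_eq_mul, one_mul] at h2
    exact h2.symm
  -- the value after the step
  have hmean : Measurable fun p : (F × F) × State d × A => p.1.1.1 p.2.1 p.2.2 :=
    hF.comp ((measurable_fst.comp measurable_fst).prodMk measurable_snd)
  have hk' := isMarkovKernel_transKer hσ _ hmean
  have e2 : ∫ ω, planV σ r (fs k ω).1 (H - 1 - h) (s k (h + 1) ω) ∂μ =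
      ∫ ω, ∫ y, planV σ r (fs k ω).1 (H - 1 - h) y
        ∂(transition σ ((fstar ω).1 (s k h ω) (a k h ω))) ∂μ := by
    exact integral_of_map_prodMk ((hmst.prodMk hmfs).prodMk (hms.prodMk hma))
      (hrun.measurable_s k (h + 1))
      (hrun.map_step hσ hh (y := fun ω => ((fstar ω, fs k ω), s k h ω, a k h ω))
        ((((measurable_fstar_stepInfo k h).prodMk (measurable_fs_stepInfo k h)).mono
          le_sup_left le_rfl).prodMk
          (((measurable_s_stepInfo le_rfl).mono le_sup_left le_rfl).prodMk
            (measurable_a_actInfo k h))) hmean fun _ => rfl)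
      (ψ := fun p : ((F × F) × State d × A) × State d => planV σ r p.1.1.2.1 (H - 1 - h) p.2)
      (hV.comp ((measurable_snd.comp (measurable_fst.comp measurable_fst)).prodMk
        measurable_snd)) fun p => hVb _ _
  have hi1 : Integrable (fun ω => planQ σ r H (fs k ω).1 h (s k h ω) (a k h ω)) μ :=
    integrable_of_abs_le (Measurable.comp (g := fun p : (F × State d) × A =>
      planQ σ r H p.1.1.1 h p.1.2 p.2) hQ ((hmfs.prodMk hms).prodMk hma)) fun ω =>
      hQb ((fs k ω, s k h ω), a k h ω)
  have hm2 : Measurable fun ω => ∫ y, planV σ r (fs k ω).1 (H - 1 - h) y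
        ∂(transition σ ((fstar ω).1 (s k h ω) (a k h ω))) :=
    measurable_integral_transition (V := fun (f : F) y => planV σ r f.1 (H - 1 - h) y) hσ
      (hF.comp (hmst.prodMk (hms.prodMk hma))) hV hmfs
  have hi2 := integrable_of_abs_le (μ := μ) hm2 fun ω =>
    abs_integral_le_of_abs_le (hVb (fs k ω))
  have hi3 : Integrable (fun ω => r (s k h ω) (a k h ω)) μ :=
    integrable_of_abs_le (Measurable.comp (g := Function.uncurry r) hr (hms.prodMk hma))
      fun ω => hr' _ _
  have hi4 : Integrable (modelError fstar fs s a k k h) μ :=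
    integrable_of_abs_le (hrun.measurable_modelError hF k k h)
      (abs_modelError_le hC k k h)
  rw [e1, e2, ← integral_sub hi1 hi2, ← integral_const_mul, ← integral_add hi3 (hi4.const_mul _)]
  refine integral_mono (hi1.sub hi2) (hi3.add (hi4.const_mul _)) fun ω => ?_
  -- The rewards cancel: the continuation is the same function with values in [0, H], integrated
  -- against Gaussians centred at f_k and f*.
  have htv := integral_transition_sub_le hσ (m₁ := (fs k ω).1 (s k h ω) (a k h ω))
    (m₂ := (fstar ω).1 (s k h ω) (a k h ω)) (modelError_le hC k k h ω)
    (V := planV σ r (fs k ω).1 (H - 1 - h))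
    (measurable_section (ψ := fun (f : F) x => planV σ r f.1 (H - 1 - h) x) hV (fs k ω)) (b := H)
    (fun y => (planV_mem_Icc hσ hr01 _ y).1) (fun y => (le_abs_self _).trans (hVb _ y))
  simp only [planQ, modelError] at htv ⊢
  linarith

/-- This yields integrability of the regret and the trivial bound used when K is small. -/
lemma regret_term_mem_Icc [Nonempty A] (hσ : 0 < σ)
    (hF : Measurable fun x : F × State d × A => x.1.1 x.2.1 x.2.2)
    (hr01 : ∀ x a, r x a ∈ Set.Icc (0 : ℝ) 1) (f : F) (π : Policy d A) (x : State d) :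
    optValue σ r H f.1 x - value σ r H f.1 π x ∈ Set.Icc (0 : ℝ) H := by
  have hv := fun π => value_mem_Icc hσ (measurable_of_mem hF f) hr01 π x H
  have : Nonempty (Policy d A) := ⟨π⟩
  have h1 : optValue σ r H f.1 x ≤ H := ciSup_le fun π => (hv π).2
  have h2 : value σ r H f.1 π x ≤ optValue σ r H f.1 x :=
    le_ciSup (f := fun π => value σ r H f.1 π x)
      ⟨H, by rintro _ ⟨π, rfl⟩; exact (hv π).2⟩ π
  exact ⟨by linarith, by linarith [(hv π).1]⟩

/-- The expected regret of an episode is bounded by the expected errors of the sampled model. -/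
lemma IsThompsonRun.integral_regret_term_le [Nonempty A] [IsProbabilityMeasure ρ] (hσ : 0 < σ)
    (hF : Measurable fun x : F × State d × A => x.1.1 x.2.1 x.2.2)
    (hr : Measurable (Function.uncurry r)) (hr01 : ∀ x a, r x a ∈ Set.Icc (0 : ℝ) 1)
    (hplan : IsGreedyPlanner σ r H plan) {C : ℝ} (hC : ∀ f ∈ F, fnNorm f ≤ ENNReal.ofReal C)
    (hrun : IsThompsonRun σ H ρ P plan μ fstar post fs s a) (k : ℕ) :
    ∫ ω, (optValue σ r H (fstar ω).1 (s k 0 ω) -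
        value σ r H (fstar ω).1 (plannedPolicy plan (fs k ω)) (s k 0 ω)) ∂μ ≤
      H * ((Real.exp ((2 * max C 0) ^ 2 / σ ^ 2) + 1) / (2 * σ)) *
        ∑ h ∈ Finset.range H, ∫ ω, modelError fstar fs s a k k h ω ∂μ := by
  have hV := measurable_planV hσ hF hr hr01 hplan le_rfl
  have hVb : ∀ (f : F) x, |planV σ r f.1 H x| ≤ H := fun f x => abs_planV_le hσ hr01 le_rfl x
  have hm1 := hrun.measurable_fstar.prodMk (hrun.measurable_s k 0)
  have hm2 := (hrun.measurable_fs k).prodMk (hrun.measurable_s k 0)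
  -- The only use of posterior sampling on values: in expectation f* may be exchanged for f_k at the
  -- initial state.
  have e1 : ∫ ω, planV σ r (fstar ω).1 H (s k 0 ω) ∂μ = ∫ ω, planV σ r (fs k ω).1 H (s k 0 ω) ∂μ := by
    rw [← integral_map (φ := fun ω => (fstar ω, s k 0 ω)) (f := fun p => planV σ r p.1.1 H p.2)
      hm1.aemeasurable hV.aestronglyMeasurable, ← hrun.map_init_eq k,
      integral_map hm2.aemeasurable hV.aestronglyMeasurable]
  have htel : ∀ t ≤ H, ∫ ω, planV σ r (fs k ω).1 H (s k 0 ω) ∂μ -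
      ∫ ω, planV σ r (fs k ω).1 (H - t) (s k t ω) ∂μ ≤
      ∑ h ∈ Finset.range t, ∫ ω, r (s k h ω) (a k h ω) ∂μ +
      H * ((Real.exp ((2 * max C 0) ^ 2 / σ ^ 2) + 1) / (2 * σ)) *
        ∑ h ∈ Finset.range t, ∫ ω, modelError fstar fs s a k k h ω ∂μ := by
    intro t
    induction t with
    | zero => intro _; simp
    | succ t ih =>
      intro ht
      have h1 := hrun.integral_planV_sub_le hσ hF hr hr01 hplan hC k (h := t) (by omega)
      have h2 := ih (by omega)
      have hH : H - (t + 1) = H - 1 - t := by omega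
      rw [Finset.sum_range_succ, Finset.sum_range_succ, hH, mul_add]
      linarith
  simp_rw [optValue_eq_planV hσ hF hr hr01 hplan]
  rw [integral_sub, hrun.integral_value hσ hF hr hr01, e1]
  · have := htel H le_rfl
    simp only [Nat.sub_self, planV, integral_zero, sub_zero] at this
    linarith
  · exact integrable_of_abs_le (hV.comp hm1) fun ω => hVb _ _
  · refine integrable_of_abs_le ((measurable_value_plannedPolicy hσ hF hr).comp
      (hrun.measurable_fstar.prodMk ((hrun.measurable_fs k).prodMk (hrun.measurable_s k 0))))
      (b := H) fun ω => ?_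
    have := value_mem_Icc hσ (measurable_of_mem hF (fstar ω)) hr01
      (plannedPolicy plan (fs k ω)) (s k 0 ω) H
    exact (abs_of_nonneg this.1).trans_le this.2

end Regret

/-! ### Closeness on the data of functions with typical residuals -/

section Fit

variable {d : ℕ} {A ι : Type*} [Fintype ι]

/-- The squared distance of two functions on the data. -/
noncomputable def dataGap (D : ι → State d × A × State d) (f g : State d → A → State d) : ℝ :=
  ∑ i, ‖g (D i).1 (D i).2.1 - f (D i).1 (D i).2.1‖ ^ 2

/-- The correlation of the residuals of `f` with `g - f` on the data. -/
noncomputable def dataCross (D : ι → State d × A × State d) (f g : State d → A → State d) : ℝ :=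
  ∑ i, inner ℝ ((D i).2.2 - f (D i).1 (D i).2.1) (g (D i).1 (D i).2.1 - f (D i).1 (D i).2.1)

lemma dataGap_le_of_close {D : ι → State d × A × State d} {f g : State d → A → State d} {α : ℝ}
    (h : ∀ x a, ‖g x a - f x a‖ ≤ α) : dataGap D f g ≤ Fintype.card ι * α ^ 2 := by
  calc dataGap D f g ≤ ∑ _i : ι, α ^ 2 := by
        refine Finset.sum_le_sum fun i _ => ?_
        have := h (D i).1 (D i).2.1
        gcongr
    _ = _ := by simp

/-- Expanding the square, 2·cross(b, c) − gap(b, c) is the squared loss of b minus that of c. In the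
combination on the right all four losses cancel. -/
lemma dataGap_add_dataGap (D : ι → State d × A × State d) (u v p q : State d → A → State d) :
    dataGap D u q + dataGap D v p = 2 * dataCross D u q - 2 * dataCross D u p + dataGap D u p
      - 2 * dataCross D v q + 2 * dataCross D v p + dataGap D v q := by
  unfold dataGap dataCross
  simp only [Finset.mul_sum, ← Finset.sum_add_distrib, ← Finset.sum_sub_distrib]
  refine Finset.sum_congr rfl fun i _ => ?_
  set y := (D i).2.2
  set u' := u (D i).1 (D i).2.1
  set v' := v (D i).1 (D i).2.1
  set p' := p (D i).1 (D i).2.1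
  set q' := q (D i).1 (D i).2.1
  have key : ∀ b c : State d,
      ‖y - c‖ ^ 2 = ‖y - b‖ ^ 2 - 2 * inner ℝ (y - b) (c - b) + ‖c - b‖ ^ 2 := fun b c => by
    rw [← norm_sub_sq_real]
    congr 2
    module
  have h1 := key u' q'
  have h2 := key u' p'
  have h3 := key v' q'
  have h4 := key v' p'
  linarith

lemma dataGap_le_two_mul (D : ι → State d × A × State d) (u v q : State d → A → State d) :
    dataGap D u v ≤ 2 * dataGap D u q + 2 * dataGap D v q := by
  unfold dataGap
  rw [Finset.mul_sum, Finset.mul_sum, ← Finset.sum_add_distrib]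
  refine Finset.sum_le_sum fun i _ => ?_
  set u' := u (D i).1 (D i).2.1
  set v' := v (D i).1 (D i).2.1
  set q' := q (D i).1 (D i).2.1
  have h : ‖v' - u'‖ ≤ ‖q' - u'‖ + ‖q' - v'‖ := by
    have := norm_sub_le (q' - u') (q' - v')
    rwa [sub_sub_sub_cancel_left] at this
  have h0 := norm_nonneg (v' - u')
  nlinarith [sq_nonneg (‖q' - u'‖ - ‖q' - v'‖)]

/-- Two functions whose residuals are both nearly uncorrelated with a fine net are close on the
data. -/
lemma dataGap_le_of_typical {D : ι → State d × A × State d} {N : Finset (State d → A → State d)}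
    {u v p q : State d → A → State d} {B α : ℝ} (hp : p ∈ N) (hq : q ∈ N)
    (hpu : ∀ x a, ‖p x a - u x a‖ ≤ α) (hqv : ∀ x a, ‖q x a - v x a‖ ≤ α)
    (hu : ∀ g ∈ N, |2 * dataCross D u g| ≤ B + dataGap D u g / 2)
    (hv : ∀ g ∈ N, |2 * dataCross D v g| ≤ B + dataGap D v g / 2) :
    dataGap D u v ≤ 16 * B + 14 * (Fintype.card ι * α ^ 2) := by
  -- Absorbing half of gap(u, q) + gap(v, p) into the left side of the identity leaves gap(u, q) ≤
  -- 8B + 6nα², n being the number of data points. Passing from q to v doubles this and adds 2nα².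
  have h1 := (le_abs_self _).trans (hu q hq)
  have h2 := (neg_le_abs _).trans (hu p hp)
  have h3 := (le_abs_self _).trans (hv p hp)
  have h4 := (neg_le_abs _).trans (hv q hq)
  have h5 := dataGap_add_dataGap D u v p q
  have h6 := dataGap_le_two_mul D u v q
  have h7 := dataGap_le_of_close (D := D) hpu
  have h8 := dataGap_le_of_close (D := D) hqv
  have h9 : 0 ≤ dataGap D v p := Finset.sum_nonneg fun i _ => sq_nonneg _
  linarith

end Fit

/-! ### The exponential martingale and concentration of residuals -/

section Concentration

variable {d : ℕ} {A : Type*} [MeasurableSpace A] {σ : ℝ}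
  {F : Set (State d → A → State d)} [MeasurableSpace F] {H : ℕ}
  {plan : ℕ → Kernel (F × State d) A} {Ω : Type*}
  {fstar : Ω → F} {post : ℕ → Ω → Measure F}
  {fs : ℕ → Ω → F} {s : ℕ → ℕ → Ω → State d} {a : ℕ → ℕ → Ω → A} {ρ : Measure (State d)}
  {P : Measure F}

/-- The transitions of the first `k` episodes. -/
def history (H : ℕ) (s : ℕ → ℕ → Ω → State d) (a : ℕ → ℕ → Ω → A) (k : ℕ) (ω : Ω) :
    Fin k × Fin H → State d × A × State d :=
  fun i => (s i.1 i.2 ω, a i.1 i.2 ω, s i.1 (i.2 + 1) ω)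

lemma measurable_history (k : ℕ) : Measurable[historyInfo H s a k] (history H s a k) :=
  @measurable_pi_lambda _ _ _ (historyInfo H s a k) _ _
    fun i => measurable_historyInfo i.1.2 i.2.2

/-- The factor contributed by one transition to the exponential martingale in the direction
`v`. -/
noncomputable def noiseFactor (σ : ℝ) (fstar : Ω → F) (s : ℕ → ℕ → Ω → State d)
    (a : ℕ → ℕ → Ω → A) (v : F × State d × A → State d) (j h : ℕ) (ω : Ω) : ℝ≥0∞ :=
  ENNReal.ofReal (Real.exp
    (inner ℝ (s j (h + 1) ω - (fstar ω).1 (s j h ω) (a j h ω)) (v (fstar ω, s j h ω, a j h ω))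
      / (2 * σ ^ 2) - ‖v (fstar ω, s j h ω, a j h ω)‖ ^ 2 / (8 * σ ^ 2)))

lemma measurable_noiseFactor {m : MeasurableSpace Ω}
    (hF : Measurable fun x : F × State d × A => x.1.1 x.2.1 x.2.2)
    {v : F × State d × A → State d} (hv : Measurable v) {j h : ℕ} (hfstar : Measurable fstar)
    (hs : Measurable (s j h)) (ha : Measurable (a j h)) (hs' : Measurable (s j (h + 1))) :
    Measurable (noiseFactor σ fstar s a v j h) := by
  have h1 : Measurable fun ω => (fstar ω, s j h ω, a j h ω) := hfstar.prodMk (hs.prodMk ha)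
  have h2 : Measurable fun ω => (fstar ω).1 (s j h ω) (a j h ω) := hF.comp h1
  have h3 : Measurable fun ω => v (fstar ω, s j h ω, a j h ω) := hv.comp h1
  exact (((((hs'.sub h2).inner h3).div_const _).sub
    ((h3.norm.pow_const 2).div_const _)).exp).ennreal_ofReal

variable [mΩ : MeasurableSpace Ω] {μ : Measure Ω} [IsProbabilityMeasure μ]

/-- Given everything up to the action, the factor has conditional mean one. Values in `ℝ≥0∞` spare
all integrability questions. -/
lemma IsThompsonRun.lintegral_mul_noiseFactor (hσ : 0 < σ)
    (hF : Measurable fun x : F × State d × A => x.1.1 x.2.1 x.2.2)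
    (hrun : IsThompsonRun σ H ρ P plan μ fstar post fs s a)
    {v : F × State d × A → State d} (hv : Measurable v) {k h : ℕ} (hh : h < H) {W : Ω → ℝ≥0∞}
    (hW : Measurable[stepInfo H fstar fs s a k h] W) :
    ∫⁻ ω, W ω * noiseFactor σ fstar s a v k h ω ∂μ = ∫⁻ ω, W ω ∂μ := by
  have hmean : Measurable fun p : ℝ≥0∞ × F × State d × A => p.2.1.1 p.2.2.1 p.2.2.2 :=
    hF.comp measurable_snd
  have := isMarkovKernel_transKer hσ _ hmean
  have hy : Measurable[stepInfo H fstar fs s a k h ⊔ MeasurableSpace.comap (a k h) inferInstance]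
      fun ω => (W ω, fstar ω, s k h ω, a k h ω) :=
    (hW.mono le_sup_left le_rfl).prodMk
      (((measurable_fstar_stepInfo k h).mono le_sup_left le_rfl).prodMk
        (((measurable_s_stepInfo le_rfl).mono le_sup_left le_rfl).prodMk
          (measurable_a_actInfo k h)))
  have hvm : Measurable fun p : (ℝ≥0∞ × F × State d × A) × State d => v p.1.2 :=
    hv.comp (measurable_snd.comp measurable_fst)
  have hψ : Measurable fun p : (ℝ≥0∞ × F × State d × A) × State d => p.1.1 * ENNReal.ofReal
      (Real.exp (inner ℝ (p.2 - p.1.2.1.1 p.1.2.2.1 p.1.2.2.2) (v p.1.2) / (2 * σ ^ 2)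
        - ‖v p.1.2‖ ^ 2 / (8 * σ ^ 2))) :=
    (measurable_fst.comp measurable_fst).mul
      (((((measurable_snd.sub (hmean.comp measurable_fst)).inner hvm).div_const _).sub
        ((hvm.norm.pow_const 2).div_const _)).exp).ennreal_ofReal
  have h1 := lintegral_of_map_prodMk (hy.mono (hrun.actInfo_le k h) le_rfl)
    (hrun.measurable_s k (h + 1)) (hrun.map_step hσ hh hy hmean fun _ => rfl) hψ
  refine h1.trans (lintegral_congr fun ω => ?_)
  have h2 := lintegral_exp_inner hσ ((fstar ω).1 (s k h ω) (a k h ω))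
    (v (fstar ω, s k h ω, a k h ω))
  have hc : Measurable fun y : State d => ENNReal.ofReal (Real.exp
      (inner ℝ (y - (fstar ω).1 (s k h ω) (a k h ω)) (v (fstar ω, s k h ω, a k h ω))
        / (2 * σ ^ 2) - ‖v (fstar ω, s k h ω, a k h ω)‖ ^ 2 / (8 * σ ^ 2))) := by
    fun_prop
  simp only [transKer_apply]
  rw [lintegral_const_mul _ hc, h2, mul_one]

lemma IsThompsonRun.lintegral_prod_noiseFactor (hσ : 0 < σ)
    (hF : Measurable fun x : F × State d × A => x.1.1 x.2.1 x.2.2)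
    (hrun : IsThompsonRun σ H ρ P plan μ fstar post fs s a)
    {v : F × State d × A → State d} (hv : Measurable v) (k : ℕ) :
    ∫⁻ ω, ∏ j ∈ Finset.range k, ∏ h ∈ Finset.range H, noiseFactor σ fstar s a v j h ω ∂μ = 1 := by
  induction k with
  | zero => simp
  | succ k ih =>
    -- The factors of the last episode are peeled off from the latest to the earliest; all those
    -- that remain are known before the action.
    have key : ∀ t ≤ H, ∫⁻ ω, (∏ j ∈ Finset.range k, ∏ h ∈ Finset.range H,
        noiseFactor σ fstar s a v j h ω) * ∏ h ∈ Finset.range t, noiseFactor σ fstar s a v k h ω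
          ∂μ = 1 := by
      intro t
      induction t with
      | zero => intro _; simpa using ih
      | succ t iht =>
        intro ht
        simp_rw [Finset.prod_range_succ, ← mul_assoc]
        rw [hrun.lintegral_mul_noiseFactor hσ hF hv (by omega), iht (by omega)]
        refine Measurable.mul ?_ ?_
        · refine Finset.measurable_prod _ fun j hj => Finset.measurable_prod _ fun h hh => ?_
          rw [Finset.mem_range] at hj hh
          have h3 : Measurable[stepInfo H fstar fs s a k t]
              fun ω => (s j h ω, a j h ω, s j (h + 1) ω) :=
            (measurable_historyInfo hj hh).mono (historyInfo_le_stepInfo k t) le_rfl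
          exact measurable_noiseFactor hF hv (measurable_fstar_stepInfo k t) h3.fst h3.snd.fst
            h3.snd.snd
        · refine Finset.measurable_prod _ fun h hh => ?_
          rw [Finset.mem_range] at hh
          exact measurable_noiseFactor hF hv (measurable_fstar_stepInfo k t)
            (measurable_s_stepInfo hh.le) (measurable_a_stepInfo hh) (measurable_s_stepInfo hh)
    simp_rw [Finset.prod_range_succ]
    exact key H le_rfl

/-- An exponential tail bound for the noise in a fixed direction. -/
lemma IsThompsonRun.measure_noise_le (hσ : 0 < σ)
    (hF : Measurable fun x : F × State d × A => x.1.1 x.2.1 x.2.2)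
    (hrun : IsThompsonRun σ H ρ P plan μ fstar post fs s a) (k : ℕ) {g : State d → A → State d}
    (hg : g ∈ F) {e : ℝ} (he : |e| = 1) (L : ℝ) :
    μ {ω | 4 * σ ^ 2 * L + dataGap (history H s a k ω) (fstar ω).1 g / 2 <
        e * (2 * dataCross (history H s a k ω) (fstar ω).1 g)} ≤
      ENNReal.ofReal (Real.exp (-L)) := by
  -- The direction e(g − f*) may depend on the true model, and e = ±1 covers both tails.
  have hv : Measurable fun p : F × State d × A => e • (g p.2.1 p.2.2 - p.1.1 p.2.1 p.2.2) :=
    (((measurable_of_mem hF ⟨g, hg⟩).comp measurable_snd).sub hF).const_smul e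
  have h1 := hrun.lintegral_prod_noiseFactor hσ hF hv k
  have h2 : ∀ ω, ∏ j ∈ Finset.range k, ∏ h ∈ Finset.range H, noiseFactor σ fstar s a
      (fun p : F × State d × A => e • (g p.2.1 p.2.2 - p.1.1 p.2.1 p.2.2)) j h ω =
      ENNReal.ofReal (Real.exp (e * dataCross (history H s a k ω) (fstar ω).1 g / (2 * σ ^ 2)
        - dataGap (history H s a k ω) (fstar ω).1 g / (8 * σ ^ 2))) := by
    intro ω
    unfold noiseFactor dataCross dataGap
    rw [Finset.mul_sum, Finset.sum_div, Finset.sum_div, ← Finset.sum_sub_distrib,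
      Fintype.sum_prod_type, Finset.prod_range]
    simp_rw [Finset.prod_range]
    rw [Real.exp_sum, ENNReal.ofReal_prod_of_nonneg fun _ _ => (Real.exp_pos _).le]
    refine Finset.prod_congr rfl fun j _ => ?_
    rw [Real.exp_sum, ENNReal.ofReal_prod_of_nonneg fun _ _ => (Real.exp_pos _).le]
    refine Finset.prod_congr rfl fun h _ => ?_
    simp only [history, inner_smul_right, norm_smul, Real.norm_eq_abs, he, one_mul]
  simp_rw [h2] at h1
  have hmeas : AEMeasurable (fun ω => ENNReal.ofReal (Real.exp (e * dataCross (history H s a k ω)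
      (fstar ω).1 g / (2 * σ ^ 2) - dataGap (history H s a k ω) (fstar ω).1 g / (8 * σ ^ 2)))) μ := by
    simp_rw [← h2]
    refine (Finset.measurable_prod _ fun j _ => Finset.measurable_prod _ fun h _ => ?_).aemeasurable
    exact measurable_noiseFactor hF hv hrun.measurable_fstar (hrun.measurable_s j h)
      (hrun.measurable_a j h) (hrun.measurable_s j (h + 1))
  have h3 := mul_meas_ge_le_lintegral₀ hmeas (ENNReal.ofReal (Real.exp L))
  rw [h1] at h3
  have h4 : μ {ω | 4 * σ ^ 2 * L + dataGap (history H s a k ω) (fstar ω).1 g / 2 <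
        e * (2 * dataCross (history H s a k ω) (fstar ω).1 g)} ≤
      μ {ω | ENNReal.ofReal (Real.exp L) ≤ ENNReal.ofReal (Real.exp (e * dataCross
        (history H s a k ω) (fstar ω).1 g / (2 * σ ^ 2) -
          dataGap (history H s a k ω) (fstar ω).1 g / (8 * σ ^ 2)))} := by
    refine measure_mono fun ω hω => ?_
    refine ENNReal.ofReal_le_ofReal (Real.exp_le_exp.2 ?_)
    have hω' : 4 * σ ^ 2 * L + dataGap (history H s a k ω) (fstar ω).1 g / 2 <
        e * (2 * dataCross (history H s a k ω) (fstar ω).1 g) := hω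
    -- On the event the exponent exceeds L, so Markov's inequality for a variable of mean one gives
    -- exp(−L).
    have h5 : e * dataCross (history H s a k ω) (fstar ω).1 g / (2 * σ ^ 2) -
          dataGap (history H s a k ω) (fstar ω).1 g / (8 * σ ^ 2) =
        (e * (2 * dataCross (history H s a k ω) (fstar ω).1 g) -
          dataGap (history H s a k ω) (fstar ω).1 g / 2) / (4 * σ ^ 2) := by
      field_simp
      ring
    rw [h5, le_div_iff₀ (by positivity)]
    linarith
  refine h4.trans ?_
  rw [Real.exp_neg, ENNReal.ofReal_inv_of_pos (Real.exp_pos L), ENNReal.le_inv_iff_mul_le, mul_comm]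
  exact h3

/-- With high probability the sampled model is close to the true model on the data. -/
lemma IsThompsonRun.measure_lt_dataGap_le (hσ : 0 < σ)
    (hF : Measurable fun x : F × State d × A => x.1.1 x.2.1 x.2.2)
    (hrun : IsThompsonRun σ H ρ P plan μ fstar post fs s a) (k : ℕ)
    {N : Finset (State d → A → State d)} (hN : ∀ g ∈ N, g ∈ F) {α : ℝ}
    (hcover : ∀ f ∈ F, ∃ g ∈ N, ∀ x a, ‖g x a - f x a‖ ≤ α) (L : ℝ) :
    μ {ω | 16 * (4 * σ ^ 2 * L) + 14 * ((k * H : ℕ) * α ^ 2) <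
        dataGap (history H s a k ω) (fstar ω).1 (fs k ω).1} ≤
      ENNReal.ofReal (4 * N.card * Real.exp (-L)) := by
  classical
  -- The event is a set of pairs (data, function), so that it can be evaluated at f* as well as at
  -- f_k; finiteness of `N` makes it measurable.
  set bad : Set ((Fin k × Fin H → State d × A × State d) × F) :=
    {p | ∃ g ∈ N, 4 * σ ^ 2 * L + dataGap p.1 p.2.1 g / 2 < |2 * dataCross p.1 p.2.1 g|} with hbad
  have hcoord : ∀ i : Fin k × Fin H, Measurable
      fun p : (Fin k × Fin H → State d × A × State d) × F => p.1 i := fun i =>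
    (measurable_pi_apply i).comp measurable_fst
  have hf : ∀ i : Fin k × Fin H, Measurable
      fun p : (Fin k × Fin H → State d × A × State d) × F => p.2.1 (p.1 i).1 (p.1 i).2.1 :=
    fun i => hF.comp (measurable_snd.prodMk ((hcoord i).fst.prodMk (hcoord i).snd.fst))
  have hg : ∀ g ∈ N, ∀ i : Fin k × Fin H, Measurable
      fun p : (Fin k × Fin H → State d × A × State d) × F => g (p.1 i).1 (p.1 i).2.1 :=
    fun g hg i => (measurable_of_mem hF ⟨g, hN g hg⟩).comp
      ((hcoord i).fst.prodMk (hcoord i).snd.fst)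
  have hbadm : MeasurableSet bad := by
    have : bad = ⋃ g ∈ N,
        {p | 4 * σ ^ 2 * L + dataGap p.1 p.2.1 g / 2 < |2 * dataCross p.1 p.2.1 g|} := by
      ext p; simp [hbad]
    rw [this]
    refine Finset.measurableSet_biUnion _ fun g hgN => measurableSet_lt ?_ ?_
    · refine (Measurable.div_const ?_ _).const_add _
      exact Finset.measurable_sum _ fun i _ => ((hg g hgN i).sub (hf i)).norm.pow_const 2
    · refine Measurable.abs (Measurable.const_mul ?_ _)
      exact Finset.measurable_sum _ fun i _ =>
        ((hcoord i).snd.snd.sub (hf i)).inner ((hg g hgN i).sub (hf i))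
  have hδ := measurable_history (H := H) (s := s) (a := a) k
  have hδ' : Measurable (history H s a k) := hδ.mono (hrun.historyInfo_le k) le_rfl
  have hstar : μ {ω | (history H s a k ω, fstar ω) ∈ bad} ≤
      ENNReal.ofReal (2 * N.card * Real.exp (-L)) := by
    have hsub : {ω | (history H s a k ω, fstar ω) ∈ bad} ⊆ ⋃ g ∈ N,
        ({ω | 4 * σ ^ 2 * L + dataGap (history H s a k ω) (fstar ω).1 g / 2 <
          1 * (2 * dataCross (history H s a k ω) (fstar ω).1 g)} ∪
        {ω | 4 * σ ^ 2 * L + dataGap (history H s a k ω) (fstar ω).1 g / 2 <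
          (-1) * (2 * dataCross (history H s a k ω) (fstar ω).1 g)}) := by
      rintro ω ⟨g, hgN, hlt⟩
      refine Set.mem_biUnion hgN ?_
      rcases lt_abs.1 hlt with h | h
      · left
        simpa only [Set.mem_ofPred_eq, one_mul] using h
      · right
        simpa only [Set.mem_ofPred_eq, neg_one_mul] using h
    refine (measure_mono hsub).trans ((measure_biUnion_finset_le _ _).trans ?_)
    calc _ ≤ ∑ _g ∈ N, (ENNReal.ofReal (Real.exp (-L)) + ENNReal.ofReal (Real.exp (-L))) := by
          refine Finset.sum_le_sum fun g hgN => (measure_union_le _ _).trans (add_le_add ?_ ?_)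
          · exact hrun.measure_noise_le hσ hF k (hN g hgN) (by simp) L
          · exact hrun.measure_noise_le hσ hF k (hN g hgN) (by simp) L
      _ = ENNReal.ofReal (2 * N.card * Real.exp (-L)) := by
          rw [Finset.sum_const, nsmul_eq_mul, ← ENNReal.ofReal_add (Real.exp_pos _).le
            (Real.exp_pos _).le, ← ENNReal.ofReal_natCast, ← ENNReal.ofReal_mul (Nat.cast_nonneg _)]
          congr 1
          ring
  -- f_k is chosen by means of the data, so the martingale bound does not apply to it. Posterior
  -- sampling transfers the bound from f*.
  have hsample : μ {ω | (history H s a k ω, fs k ω) ∈ bad} ≤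
      ENNReal.ofReal (2 * N.card * Real.exp (-L)) := by
    have h1 := congrArg (fun ν => ν bad) (hrun.map_sample_eq k hδ)
    rw [Measure.map_apply (hδ'.prodMk (hrun.measurable_fs k)) hbadm,
      Measure.map_apply (hδ'.prodMk hrun.measurable_fstar) hbadm] at h1
    exact h1.le.trans hstar
  have hsub : {ω | 16 * (4 * σ ^ 2 * L) + 14 * ((k * H : ℕ) * α ^ 2) <
        dataGap (history H s a k ω) (fstar ω).1 (fs k ω).1} ⊆
      {ω | (history H s a k ω, fstar ω) ∈ bad} ∪ {ω | (history H s a k ω, fs k ω) ∈ bad} := by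
    intro ω hω
    by_contra hcon
    rw [Set.mem_union, not_or] at hcon
    obtain ⟨p, hpN, hp⟩ := hcover _ (fstar ω).2
    obtain ⟨q, hqN, hq⟩ := hcover _ (fs k ω).2
    have h1 := dataGap_le_of_typical (D := history H s a k ω) (B := 4 * σ ^ 2 * L) hpN hqN hp hq
      (fun g hgN => not_lt.1 fun h => hcon.1 ⟨g, hgN, h⟩)
      (fun g hgN => not_lt.1 fun h => hcon.2 ⟨g, hgN, h⟩)
    rw [Fintype.card_prod, Fintype.card_fin, Fintype.card_fin] at h1
    exact absurd hω (not_lt.2 h1)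
  refine (measure_mono hsub).trans ((measure_union_le _ _).trans
    ((add_le_add hstar hsample).trans (le_of_eq ?_)))
  rw [← ENNReal.ofReal_add (by positivity) (by positivity)]
  congr 1
  ring

end Concentration

/-! ### Summing the errors and choosing the scale -/

section Assembly

variable {d : ℕ} {A : Type*}

/-- An infimum in `ℕ∞` over a nonempty family is attained, and `F` covers itself. -/
lemma exists_finset_cover {F : Set (State d → A → State d)} {α : ℝ} (hα : 0 < α)
    (h : fnCoveringNumber F α < ⊤) :
    ∃ N : Finset (State d → A → State d), (∀ g ∈ N, g ∈ F) ∧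
      (∀ f ∈ F, ∃ g ∈ N, ∀ x a, ‖g x a - f x a‖ ≤ α) ∧
      N.card = (fnCoveringNumber F α).toNat := by
  have hne : Nonempty {N : Set (State d → A → State d) // IsFnCover F α N} :=
    ⟨F, subset_rfl, fun f hf => ⟨f, hf, by simp [fnNorm]⟩⟩
  obtain ⟨⟨N, hNF, hN⟩, hcard⟩ := ciInf_mem
    fun N : {N : Set (State d → A → State d) // IsFnCover F α N} => N.1.encard
  change N.encard = fnCoveringNumber F α at hcard
  have hfin : N.Finite := Set.encard_lt_top_iff.1 (hcard ▸ h)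
  refine ⟨hfin.toFinset, fun g hg => hNF (hfin.mem_toFinset.1 hg), fun f hf => ?_, ?_⟩
  · obtain ⟨g, hg, hfg⟩ := hN f hf
    refine ⟨g, hfin.mem_toFinset.2 hg, fun x a => ?_⟩
    have := norm_le_of_fnNorm_le hfg x a
    rw [max_eq_left hα.le] at this
    rwa [norm_sub_rev]
  · rw [← hcard, hfin.encard_eq_coe_toFinset_card, ENat.toNat_natCast]

/-- Finiteness is essential, as `toNat` sends ⊤ to 0. -/
lemma le_toNat_eluderDim {F : Set (State d → A → State d)} {α : ℝ} (h : eluderDim F α < ⊤) {n : ℕ}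
    (hn : HasEluderSequence F α n) : n ≤ (eluderDim F α).toNat := by
  have h1 : (n : ℕ∞) ≤ eluderDim F α :=
    le_iSup (fun m : {n : ℕ // HasEluderSequence F α n} => (m.1 : ℕ∞)) ⟨n, hn⟩
  have := ENat.toNat_le_toNat h1 h.ne
  rwa [ENat.toNat_natCast] at this

/-- The eluder argument needs a single time index: step h of episode k becomes kH + h. -/
lemma sum_range_mul (φ : ℕ → ℕ → ℝ) {H : ℕ} (hH : 1 ≤ H) (K : ℕ) :
    ∑ i ∈ Finset.range (K * H), φ (i / H) (i % H) =
      ∑ k ∈ Finset.range K, ∑ h ∈ Finset.range H, φ k h := by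
  induction K with
  | zero => simp
  | succ K ih =>
    rw [Nat.succ_mul, Finset.sum_range_add, ih, Finset.sum_range_succ]
    congr 1
    refine Finset.sum_congr rfl fun h hh => ?_
    rw [Finset.mem_range] at hh
    have h1 : (K * H + h) / H = K := by
      rw [mul_comm, Nat.mul_add_div (by omega), Nat.div_eq_of_lt hh, add_zero]
    have h2 : (K * H + h) % H = h := by
      rw [mul_comm, Nat.mul_add_mod, Nat.mod_eq_of_lt hh]
    rw [h1, h2]

variable {F : Set (State d → A → State d)} {H : ℕ} {Ω : Type*} {fstar : Ω → F} {fs : ℕ → Ω → F}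
  {s : ℕ → ℕ → Ω → State d} {a : ℕ → ℕ → Ω → A}

lemma dataGap_history (k : ℕ) (ω : Ω) :
    dataGap (history H s a k ω) (fstar ω).1 (fs k ω).1 =
      ∑ j ∈ Finset.range k, ∑ h ∈ Finset.range H, modelError fstar fs s a k j h ω ^ 2 := by
  unfold dataGap
  rw [Fintype.sum_prod_type, Finset.sum_range]
  simp_rw [Finset.sum_range]
  rfl

open Classical in
/-- The total error over the episodes whose sampled model fits the data of the earlier
episodes. -/
lemma sum_modelError_le {C α ε β : ℝ} (hC : ∀ f ∈ F, fnNorm f ≤ ENNReal.ofReal C) (hε : 0 < ε)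
    (hα : α ≤ ε) (hβ : 0 ≤ β) {D : ℕ} (hD : ∀ n, HasEluderSequence F α n → n ≤ D) (hH : 1 ≤ H)
    (K : ℕ) (ω : Ω) :
    ∑ k ∈ Finset.range K, ∑ h ∈ Finset.range H,
        (if dataGap (history H s a k ω) (fstar ω).1 (fs k ω).1 ≤ β
          then modelError fstar fs s a k k h ω else 0) ≤
      (K * H : ℕ) * ε + 2 * (β * D) / ε + 2 * (2 * max C 0) * (H * D) := by
  set w : ℕ → ℝ := fun i =>
    if dataGap (history H s a (i / H) ω) (fstar ω).1 (fs (i / H) ω).1 ≤ β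
      then modelError fstar fs s a (i / H) (i / H) (i % H) ω else 0 with hw
  rw [← sum_range_mul (fun k h =>
    if dataGap (history H s a k ω) (fstar ω).1 (fs k ω).1 ≤ β
      then modelError fstar fs s a k k h ω else 0) hH]
  refine sum_le_of_card_large_le (w := w) hε (by positivity) (by positivity) (by positivity)
    (fun i _ => ?_) fun η hη => ?_
  · simp only [hw]
    split_ifs
    · exact modelError_le hC _ _ _ ω
    · positivity
  have hη0 : 0 < η := hε.trans_le hη
  set x : ℕ → State d × A := fun i => (s (i / H) (i % H) ω, a (i / H) (i % H) ω) with hx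
  have hmem : ∀ i ∈ (Finset.range (K * H)).filter fun i => η < w i,
      dataGap (history H s a (i / H) ω) (fstar ω).1 (fs (i / H) ω).1 ≤ β ∧
        η < modelError fstar fs s a (i / H) (i / H) (i % H) ω := by
    intro i hi
    have h1 := (Finset.mem_filter.1 hi).2
    simp only [hw] at h1
    split_ifs at h1 with h2
    · exact ⟨h2, h1⟩
    · exact absurd h1 (not_lt.2 hη0.le)
  -- An eluder sequence at scale η ≥ α is one at scale α, so the same `D` serves all dyadic scales.
  have h := card_large_le (β := β) hη0 (hα.trans hη) hβ hD hH x (fun k => (fs k ω).1)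
    (fun _ => (fstar ω).1) (fun k => (fs k ω).2) (fun _ => (fstar ω).2)
    ((Finset.range (K * H)).filter fun i => η < w i) (fun i hi => (hmem i hi).2) fun i hi => by
      have h1 := (hmem i hi).1
      rw [dataGap_history, ← sum_range_mul (fun j h =>
        modelError fstar fs s a (i / H) j h ω ^ 2) hH] at h1
      exact h1
  refine h.trans (le_of_eq ?_)
  field_simp

variable [MeasurableSpace A] [MeasurableSpace F] {σ : ℝ} {plan : ℕ → Kernel (F × State d) A}
  {post : ℕ → Ω → Measure F} {ρ : Measure (State d)} {P : Measure F} [mΩ : MeasurableSpace Ω]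
  {μ : Measure Ω} [IsProbabilityMeasure μ]

/-- Episodes in which the sampled model fits the data obey a bound valid for every outcome; in the
others each error is at most 2 max(C, 0), weighted by the small failure probability. -/
lemma IsThompsonRun.sum_integral_modelError_le (hσ : 0 < σ)
    (hF : Measurable fun x : F × State d × A => x.1.1 x.2.1 x.2.2)
    (hrun : IsThompsonRun σ H ρ P plan μ fstar post fs s a) {C : ℝ}
    (hC : ∀ f ∈ F, fnNorm f ≤ ENNReal.ofReal C) {α ε : ℝ} (hε : 0 < ε) (hα : α ≤ ε)
    {D : ℕ} (hD : ∀ n, HasEluderSequence F α n → n ≤ D) (hH : 1 ≤ H)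
    {N : Finset (State d → A → State d)} (hN : ∀ g ∈ N, g ∈ F)
    (hcover : ∀ f ∈ F, ∃ g ∈ N, ∀ x a, ‖g x a - f x a‖ ≤ α) {L : ℝ} (hL : 0 ≤ L) {K : ℕ}
    (hK : (K * H : ℕ) * α ^ 2 ≤ 1) :
    ∑ k ∈ Finset.range K, ∑ h ∈ Finset.range H, ∫ ω, modelError fstar fs s a k k h ω ∂μ ≤
      (K * H : ℕ) * ε + 2 * ((64 * σ ^ 2 * L + 14) * D) / ε + 2 * (2 * max C 0) * (H * D) +
        (K * H : ℕ) * (2 * max C 0 * (4 * N.card * Real.exp (-L))) := by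
  classical
  -- The gap threshold 16·4σ²L + 14·kHα², with kHα² ≤ 1 by `hK`.
  set β := 64 * σ ^ 2 * L + 14 with hβ
  set R := 2 * max C 0 with hR
  have hR0 : 0 ≤ R := by positivity
  set bad : ℕ → Set Ω := fun k =>
    {ω | β < dataGap (history H s a k ω) (fstar ω).1 (fs k ω).1} with hbad
  have hbadm : ∀ k, MeasurableSet (bad k) := fun k => by
    refine measurableSet_lt measurable_const ?_
    simp_rw [dataGap_history]
    exact Finset.measurable_sum _ fun j _ => Finset.measurable_sum _ fun h _ =>
      (hrun.measurable_modelError hF k j h).pow_const 2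
  have hbadμ : ∀ k ∈ Finset.range K, μ.real (bad k) ≤ 4 * N.card * Real.exp (-L) := by
    intro k hk
    have h1 : (k * H : ℕ) * α ^ 2 ≤ 1 := by
      refine le_trans ?_ hK
      have : k * H ≤ K * H := Nat.mul_le_mul_right _ (Finset.mem_range.1 hk).le
      gcongr
    refine ENNReal.toReal_le_of_le_ofReal (by positivity) ((measure_mono fun ω hω => ?_).trans
      (hrun.measure_lt_dataGap_le hσ hF k hN hcover L))
    refine lt_of_le_of_lt ?_ (show β < _ from hω)
    rw [hβ]
    linarith
  have hint : ∀ k h, Integrable (modelError fstar fs s a k k h) μ := fun k h =>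
    integrable_of_abs_le (hrun.measurable_modelError hF k k h) (abs_modelError_le hC k k h)
  have hind : ∀ k, Integrable ((bad k).indicator fun _ => R) μ := fun k =>
    (integrable_const R).indicator (hbadm k)
  set W := (K * H : ℕ) * ε + 2 * (β * D) / ε + 2 * R * (H * D) with hW
  have hpt : ∀ ω, ∑ k ∈ Finset.range K, ∑ h ∈ Finset.range H, modelError fstar fs s a k k h ω ≤
      W + ∑ k ∈ Finset.range K, ∑ _h ∈ Finset.range H, (bad k).indicator (fun _ => R) ω := by
    intro ω
    refine le_trans ?_ (add_le_add (sum_modelError_le (fstar := fstar) (fs := fs) (s := s)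
      (a := a) (β := β) hC hε hα (by positivity) hD hH K ω) le_rfl)
    rw [← Finset.sum_add_distrib]
    refine Finset.sum_le_sum fun k _ => ?_
    rw [← Finset.sum_add_distrib]
    refine Finset.sum_le_sum fun h _ => ?_
    by_cases hgood : dataGap (history H s a k ω) (fstar ω).1 (fs k ω).1 ≤ β
    · rw [if_pos hgood, le_add_iff_nonneg_right]
      exact Set.indicator_nonneg (fun _ _ => hR0) _
    · have hmem : ω ∈ bad k := not_le.1 hgood
      rw [if_neg hgood, zero_add, Set.indicator_of_mem hmem]
      exact modelError_le hC k k h ω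
  have hI1 : ∀ k ∈ Finset.range K,
      Integrable (fun ω => ∑ h ∈ Finset.range H, modelError fstar fs s a k k h ω) μ :=
    fun k _ => integrable_finsetSum _ fun h _ => hint k h
  have hI2 : ∀ k ∈ Finset.range K,
      Integrable (fun ω => ∑ _h ∈ Finset.range H, (bad k).indicator (fun _ => R) ω) μ :=
    fun k _ => integrable_finsetSum _ fun h _ => hind k
  calc ∑ k ∈ Finset.range K, ∑ h ∈ Finset.range H, ∫ ω, modelError fstar fs s a k k h ω ∂μ
      = ∫ ω, ∑ k ∈ Finset.range K, ∑ h ∈ Finset.range H, modelError fstar fs s a k k h ω ∂μ := by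
        rw [integral_finsetSum _ hI1]
        exact Finset.sum_congr rfl fun k _ => (integral_finsetSum _ fun h _ => hint k h).symm
    _ ≤ ∫ ω, (W + ∑ k ∈ Finset.range K, ∑ _h ∈ Finset.range H,
          (bad k).indicator (fun _ => R) ω) ∂μ :=
        integral_mono (integrable_finsetSum _ hI1)
          ((integrable_const W).add (integrable_finsetSum _ hI2)) hpt
    _ = W + ∑ k ∈ Finset.range K, ∑ _h ∈ Finset.range H, R * μ.real (bad k) := by
        rw [integral_add (integrable_const W) (integrable_finsetSum _ hI2),
          integral_finsetSum _ hI2]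
        congr 1
        · simp
        · refine Finset.sum_congr rfl fun k _ => ?_
          rw [integral_finsetSum _ fun h _ => hind k]
          refine Finset.sum_congr rfl fun h _ => ?_
          rw [integral_indicator (hbadm k), setIntegral_const, smul_eq_mul, mul_comm]
    _ ≤ W + ∑ k ∈ Finset.range K, ∑ _h ∈ Finset.range H, R * (4 * N.card * Real.exp (-L)) := by
        gcongr with k hk h hh
        exact hbadμ k hk
    _ = _ := by
        rw [Finset.sum_const, Finset.sum_const, Finset.card_range, Finset.card_range]
        push_cast
        simp only [nsmul_eq_mul]
        ring

/-- The regret bound from the expected model errors, with the scale chosen optimally. -/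
lemma regret_arithmetic {κ R σ' K H D M T L ℓ reg : ℝ} (hκ : 0 ≤ κ) (hR : 0 ≤ R) (hK : 1 ≤ K)
    (hH : 1 ≤ H) (hD : 1 ≤ D) (hM : 1 ≤ M) (hT : T = K * H) (hℓ : 1 ≤ ℓ) (hL : 0 ≤ L)
    (hLM : L ≤ 3 * (M * ℓ)) (htriv : reg ≤ K * H)
    (hreg : reg ≤ H * κ * (T * Real.sqrt ((64 * σ' ^ 2 * L + 14) * D / T) +
      2 * ((64 * σ' ^ 2 * L + 14) * D) / Real.sqrt ((64 * σ' ^ 2 * L + 14) * D / T) +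
      2 * R * (H * D) + R)) :
    reg ≤ (κ * (3 * Real.sqrt (192 * σ' ^ 2 + 14) + 3 * R) + 1) * ℓ *
      Real.sqrt (H ^ 2 * T * M * D) := by
  have hT0 : 0 < T := by rw [hT]; positivity
  have hKH : 0 ≤ K * H := by positivity
  set Q := Real.sqrt (T * M * D) with hQ
  have hsq : Real.sqrt (H ^ 2 * T * M * D) = H * Q := by
    rw [hQ, show H ^ 2 * T * M * D = H ^ 2 * (T * M * D) by ring,
      Real.sqrt_mul (by positivity), Real.sqrt_sq (by positivity)]
  have hQ0 : 0 ≤ Q := Real.sqrt_nonneg _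
  rw [hsq]
  have hTD : T * D ≤ T * M * D := by
    have : T * D * 1 ≤ T * D * M := mul_le_mul_of_nonneg_left hM (by positivity)
    linarith
  set c₁ := κ * (3 * Real.sqrt (192 * σ' ^ 2 + 14) + 3 * R) with hc₁
  have hc₁0 : 0 ≤ c₁ := by positivity
  -- If K ≤ HD then K² ≤ TD, so the trivial bound KH is at most HQ. If HD ≤ K then (HD)² ≤ TD, so
  -- the term HD is at most Q.
  rcases le_total K (H * D) with hcase | hcase
  · have h1 : K ≤ Q := by
      rw [hQ]
      refine Real.le_sqrt_of_sq_le (le_trans ?_ hTD)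
      rw [hT]
      have : K * K ≤ K * (H * D) := mul_le_mul_of_nonneg_left hcase (by positivity)
      linarith
    have h2 : K * H ≤ Q * H := mul_le_mul_of_nonneg_right h1 (by positivity)
    have h3 : 1 * (H * Q) ≤ (c₁ + 1) * ℓ * (H * Q) := by
      refine mul_le_mul_of_nonneg_right ?_ (by positivity)
      exact one_le_mul_of_one_le_of_one_le (by linarith) hℓ
    linarith
  · set β := 64 * σ' ^ 2 * L + 14 with hβ
    have hβ0 : 0 < β := by positivity
    have hε : Real.sqrt (β * D / T) = Real.sqrt (β * D * T) / T := by
      rw [eq_div_iff hT0.ne']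
      nth_rewrite 2 [← Real.sqrt_sq hT0.le]
      rw [← Real.sqrt_mul (by positivity)]
      congr 1
      field_simp
    have hS0 : 0 < Real.sqrt (β * D * T) := Real.sqrt_pos.2 (by positivity)
    have hSS : Real.sqrt (β * D * T) * Real.sqrt (β * D * T) = β * D * T :=
      Real.mul_self_sqrt (by positivity)
    have e1 : T * (Real.sqrt (β * D * T) / T) = Real.sqrt (β * D * T) := by field_simp
    have e2 : 2 * (β * D) / (Real.sqrt (β * D * T) / T) = 2 * Real.sqrt (β * D * T) := by
      rw [div_div_eq_mul_div, div_eq_iff hS0.ne', mul_assoc 2 (Real.sqrt _), hSS]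
      ring
    rw [hε, e1, e2] at hreg
    have hβle : β ≤ (192 * σ' ^ 2 + 14) * (M * ℓ) := by
      have h1 : 1 ≤ M * ℓ := one_le_mul_of_one_le_of_one_le hM hℓ
      have h2 : 64 * σ' ^ 2 * L ≤ 64 * σ' ^ 2 * (3 * (M * ℓ)) := by gcongr
      have h3 : (192 * σ' ^ 2 + 14) * (M * ℓ) = 64 * σ' ^ 2 * (3 * (M * ℓ)) + 14 * (M * ℓ) := by ring
      rw [hβ, h3]
      linarith
    have hS : Real.sqrt (β * D * T) ≤ Real.sqrt (192 * σ' ^ 2 + 14) * (ℓ * Q) := by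
      have h1 : ℓ * Q = Real.sqrt (ℓ ^ 2 * (T * M * D)) := by
        rw [Real.sqrt_mul (by positivity), Real.sqrt_sq (by positivity)]
      rw [h1, ← Real.sqrt_mul (by positivity)]
      refine Real.sqrt_le_sqrt ?_
      calc β * D * T ≤ (192 * σ' ^ 2 + 14) * (M * ℓ) * D * T := by gcongr
        _ = (192 * σ' ^ 2 + 14) * (ℓ * (T * M * D)) := by ring
        -- Only the root of ℓ is needed; ℓ is used because the exponent is a natural number.
        _ ≤ (192 * σ' ^ 2 + 14) * (ℓ ^ 2 * (T * M * D)) := by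
            gcongr
            exact le_self_pow₀ hℓ two_ne_zero
    have hHD : H * D ≤ ℓ * Q := by
      have h1 : H * D ≤ Q := by
        rw [hQ]
        refine Real.le_sqrt_of_sq_le (le_trans ?_ hTD)
        rw [hT]
        have : H * D * (H * D) ≤ H * D * K := mul_le_mul_of_nonneg_left hcase (by positivity)
        linarith
      exact h1.trans (le_mul_of_one_le_left hQ0 hℓ)
    have hone : 1 ≤ ℓ * Q := (one_le_mul_of_one_le_of_one_le hH hD).trans hHD
    have hfin : 3 * Real.sqrt (β * D * T) + (2 * R * (H * D) + R) ≤
        (3 * Real.sqrt (192 * σ' ^ 2 + 14) + 3 * R) * (ℓ * Q) := by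
      have h1 : R * (H * D) ≤ R * (ℓ * Q) := mul_le_mul_of_nonneg_left hHD hR
      have h2 : R * 1 ≤ R * (ℓ * Q) := mul_le_mul_of_nonneg_left hone hR
      have h3 : (3 * Real.sqrt (192 * σ' ^ 2 + 14) + 3 * R) * (ℓ * Q) =
          3 * (Real.sqrt (192 * σ' ^ 2 + 14) * (ℓ * Q)) + 3 * (R * (ℓ * Q)) := by ring
      rw [h3]
      linarith
    calc reg ≤ H * κ * (3 * Real.sqrt (β * D * T) + (2 * R * (H * D) + R)) := by
          refine hreg.trans (le_of_eq ?_)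
          ring
      _ ≤ H * κ * ((3 * Real.sqrt (192 * σ' ^ 2 + 14) + 3 * R) * (ℓ * Q)) := by gcongr
      _ = c₁ * ℓ * (H * Q) := by rw [hc₁]; ring
      _ ≤ (c₁ + 1) * ℓ * (H * Q) := by
          gcongr
          linarith

end Assembly

end SPEDE

/-! ### The regret bound -/

theorem theorem1 :
    ∃ p : ℕ, ∀ (d : ℕ) (σ C : ℝ), 0 < σ → ∃ c : ℝ,
      ∀ (A : Type*) [MeasurableSpace A]
        (F : Set (SPEDE.State d → A → SPEDE.State d)) [MeasurableSpace F],
        Measurable (fun x : F × SPEDE.State d × A => x.1.1 x.2.1 x.2.2) →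
        (∀ f ∈ F, SPEDE.fnNorm f ≤ ENNReal.ofReal C) →
        (∀ ε : ℝ, 0 < ε → SPEDE.fnCoveringNumber F ε < ⊤) →
        (∀ ε : ℝ, 0 < ε → SPEDE.eluderDim F ε < ⊤) →
      ∀ (r : SPEDE.State d → A → ℝ), Measurable (Function.uncurry r) →
        (∀ x a, r x a ∈ Set.Icc (0 : ℝ) 1) →
      ∀ (H : ℕ), 1 ≤ H →
      ∀ (ρ : Measure (SPEDE.State d)) [IsProbabilityMeasure ρ]
        (P : Measure F) [IsProbabilityMeasure P]
        (plan : ℕ → Kernel (F × SPEDE.State d) A) [∀ h, IsMarkovKernel (plan h)],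
        SPEDE.IsGreedyPlanner σ r H plan →
      ∀ (Ω : Type*) [MeasurableSpace Ω] (μ : Measure Ω) [IsProbabilityMeasure μ]
        (fstar : Ω → F) (post : ℕ → Ω → Measure F) (fs : ℕ → Ω → F)
        (s : ℕ → ℕ → Ω → SPEDE.State d) (a : ℕ → ℕ → Ω → A),
        SPEDE.IsThompsonRun σ H ρ P plan μ fstar post fs s a →
      ∀ (K : ℕ), 1 ≤ K → ∀ (T : ℝ), T = (K : ℝ) * (H : ℝ) →
        Integrable (SPEDE.regret σ r H plan fstar fs s K) μ ∧
        ∫ ω, SPEDE.regret σ r H plan fstar fs s K ω ∂μ ≤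
          c * (1 + Real.log T) ^ p *
            Real.sqrt ((H : ℝ) ^ 2 * T *
              max 1 (Real.log ((SPEDE.fnCoveringNumber F (T ^ (-(1 / 2 : ℝ)))).toNat : ℝ)) *
              max 1 ((SPEDE.eluderDim F (T ^ (-(1 / 2 : ℝ)))).toNat : ℝ)) := by
  -- The first factor is the total variation constant for model errors of size up to 2 max(C, 0);
  -- the summand 1 pays for the case of few episodes.
  refine ⟨1, fun d σ C hσ => ⟨((Real.exp ((2 * max C 0) ^ 2 / σ ^ 2) + 1) / (2 * σ)) *
    (3 * Real.sqrt (192 * σ ^ 2 + 14) + 3 * (2 * max C 0)) + 1, ?_⟩⟩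
  intro A _ F _ hF hC hcov helu r hr hr01 H hH ρ _ P _ plan _ hplan Ω _ μ _ fstar post fs s a hrun
    K hK T hT
  have hFne : Nonempty F := P.nonempty_of_neZero
  have hAne : Nonempty A := (plan 0 (hFne.some, 0)).nonempty_of_neZero
  have hKr : (1 : ℝ) ≤ K := by exact_mod_cast hK
  have hHr : (1 : ℝ) ≤ H := by exact_mod_cast hH
  have hT1 : 1 ≤ T := by rw [hT]; nlinarith
  have hT0 : 0 < T := by linarith
  have hlogT : 0 ≤ Real.log T := Real.log_nonneg hT1
  set α := T ^ (-(1 / 2 : ℝ)) with hα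
  have hα0 : 0 < α := Real.rpow_pos_of_pos hT0 _
  have hα2 : α ^ 2 = 1 / T := by
    rw [hα, ← Real.rpow_natCast, ← Real.rpow_mul hT0.le]
    norm_num
    rw [Real.rpow_neg_one]
  obtain ⟨N, hNF, hNcov, hNcard⟩ := SPEDE.exists_finset_cover hα0 (hcov α hα0)
  have hNpos : (1 : ℝ) ≤ N.card := by
    obtain ⟨g, hg, _⟩ := hNcov _ hFne.some.2
    exact_mod_cast Finset.card_pos.2 ⟨g, hg⟩
  rw [← hNcard]
  set D₀ := (SPEDE.eluderDim F α).toNat with hD₀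
  -- At least 1, so that the optimal scale below is not smaller than α.
  set D := max 1 D₀ with hD
  have hDle : ∀ n, SPEDE.HasEluderSequence F α n → n ≤ D := fun n hn =>
    (SPEDE.le_toNat_eluderDim (helu α hα0) hn).trans (le_max_right _ _)
  have hDcast : max 1 (D₀ : ℝ) = (D : ℝ) := by rw [hD]; push_cast; rfl
  rw [hDcast]
  have hD1 : (1 : ℝ) ≤ D := by exact_mod_cast le_max_left 1 D₀
  set M := max 1 (Real.log (N.card : ℝ)) with hM
  -- With this L an episode fails with probability at most 1/T, so failures cost at most 2 max(C, 0)
  -- over all T steps.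
  set L := Real.log (4 * N.card * T) with hL
  have hL0 : 0 ≤ L := Real.log_nonneg (by nlinarith)
  have hexpL : 4 * N.card * Real.exp (-L) = 1 / T := by
    rw [Real.exp_neg, hL, Real.exp_log (by positivity)]
    field_simp
  have hLM : L ≤ 3 * (M * (1 + Real.log T)) := by
    rw [hL, Real.log_mul (by positivity) hT0.ne', Real.log_mul (by norm_num) (by positivity)]
    have h1 : Real.log 4 ≤ 2 := by
      rw [show (4 : ℝ) = 2 ^ 2 by norm_num, Real.log_pow]
      have := Real.log_two_lt_d9
      push_cast
      linarith
    have h2 : Real.log N.card ≤ M := le_max_right _ _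
    have h3 : 1 ≤ M := le_max_left _ _
    nlinarith
  have hterm : ∀ k, Integrable (fun ω => SPEDE.optValue σ r H (fstar ω).1 (s k 0 ω) -
      SPEDE.value σ r H (fstar ω).1 (SPEDE.plannedPolicy plan (fs k ω)) (s k 0 ω)) μ := fun k =>
    SPEDE.integrable_of_abs_le (hrun.measurable_regret_term hσ hF hr hr01 hplan k) fun ω => by
      have := SPEDE.regret_term_mem_Icc (H := H) hσ hF hr01 (fstar ω)
        (SPEDE.plannedPolicy plan (fs k ω)) (s k 0 ω)
      exact (abs_of_nonneg this.1).trans_le this.2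
  refine ⟨integrable_finsetSum _ fun k _ => hterm k, ?_⟩
  have hsum : ∫ ω, SPEDE.regret σ r H plan fstar fs s K ω ∂μ = ∑ k ∈ Finset.range K,
      ∫ ω, (SPEDE.optValue σ r H (fstar ω).1 (s k 0 ω) -
        SPEDE.value σ r H (fstar ω).1 (SPEDE.plannedPolicy plan (fs k ω)) (s k 0 ω)) ∂μ :=
    integral_finsetSum _ fun k _ => hterm k
  have hKH : ((K * H : ℕ) : ℝ) = T := by rw [hT]; push_cast; rfl
  rw [pow_one]
  refine SPEDE.regret_arithmetic (K := K) (L := L) (by positivity) (by positivity) hKr hHr hD1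
    (le_max_left _ _) hT (by linarith) hL0 hLM ?_ ?_
  · rw [hsum]
    calc _ ≤ ∑ _k ∈ Finset.range K, (H : ℝ) := by
          refine Finset.sum_le_sum fun k _ => ?_
          refine (integral_mono (hterm k) (integrable_const (H : ℝ)) fun ω =>
            (SPEDE.regret_term_mem_Icc (H := H) hσ hF hr01 (fstar ω) _ _).2).trans ?_
          simp
      _ = K * H := by simp
  · rw [hsum]
    have hβD : 1 ≤ (64 * σ ^ 2 * L + 14) * D := by
      have : 0 ≤ 64 * σ ^ 2 * L := by positivity
      nlinarith
    -- The eluder dimension is taken at scale α = T^{-1/2}, so the summation must start at a scale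
    -- at least α; this holds as βD ≥ 1.
    have hαε : α ≤ Real.sqrt ((64 * σ ^ 2 * L + 14) * D / T) := by
      refine Real.le_sqrt_of_sq_le ?_
      rw [hα2]
      gcongr
    have herr := hrun.sum_integral_modelError_le hσ hF hC (hα0.trans_le hαε) hαε hDle hH hNF hNcov
      hL0 (K := K) (by rw [hKH, hα2]; field_simp; exact le_rfl)
    rw [hexpL, hKH] at herr
    have hRT : T * (2 * max C 0 * (1 / T)) = 2 * max C 0 := by field_simp
    rw [hRT] at herr
    calc _ ≤ ∑ k ∈ Finset.range K, (H : ℝ) *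
          ((Real.exp ((2 * max C 0) ^ 2 / σ ^ 2) + 1) / (2 * σ)) *
            ∑ h ∈ Finset.range H, ∫ ω, SPEDE.modelError fstar fs s a k k h ω ∂μ :=
          Finset.sum_le_sum fun k _ => hrun.integral_regret_term_le hσ hF hr hr01 hplan hC k
      _ ≤ _ := by
          rw [← Finset.mul_sum]
          exact mul_le_mul_of_nonneg_left herr (by positivity)
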